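/- Let $\mathbb{K}\in\{\mathbb{R},\mathbb{C}\}$ and let $\mathcal{B}$ be a Banach space over $\mathbb{K}$ that is either reflexive and separable, or a Hilbert space (possibly non-separable). For a normed space $E$ and a function $S:[0,\infty)\to\mathcal{L}(E)$ (bounded linear operators on $E$), let $S'(0)$ denote the linear operator $S'(0)\psi=\lim_{h\downarrow 0}h^{-1}(S(h)\psi-S(0)\psi)$ (limit in norm), whose domain $\mathcal{D}(S'(0))$ is the set of all $\psi\in E$ for which this limit exists. A $C_0$-semigroup on $\mathcal{B}$ is a function $T:[0,\infty)\to\mathcal{L}(\mathcal{B})$ with $T(0)=I$ and $T(l+m)=T(l)T(m)$ for all $l,m\ge 0$, that is strongly continuous and satisfies $\|T(s)\|\le Me^{as}$ for all $s\ge 0$, for some $M>1$, $a\in\mathbb{R}$; its generator is $T'(0)$. Let $Z:\mathcal{B}\supset\mathcal{D}(Z)\to\mathcal{B}$ be a linear operator with $\mathcal{D}(Z)$ dense in $\mathcal{B}$, and let $t>0$. Let $F:[0,\infty)\to\mathcal{L}(\mathcal{B})$ be a function such that: (i) $F(0)=I$ and there exist $a\in\mathbb{R}$, $M\ge 1$ such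 that $\|F(s/n)^m\|\le M\exp(as\tfrac{m}{n})$ for all $n,m\in\mathbb{N}$, $n\ge 1$, and all $s\ge 0$; (ii) $\mathcal{D}(Z)\subset\mathcal{D}(F'(0))$ and $F'(0)f=Zf$ for all $f\in\mathcal{D}(Z)$; (iii) $\mathcal{D}((F^*)'(0))$ is weak-* dense in $\mathcal{B}^*$, where $F^*:[0,\infty)\to\mathcal{L}(\mathcal{B}^*)$, $F^*(s)=(F(s))^*$. Then $Z$ is closable and its closure is the generator of a $C_0$-semigroup on $\mathcal{B}$ if and only if there exists a linear subspace $A\subseteq\mathcal{D}(Z)$, dense in $\mathcal{B}$, such that for every $f\in A$ and every $s\ge 0$ there is a sequence $(f_n)_{n\ge 1}$ in $\mathcal{D}(Z)$ with $$\lim_{n\to\infty}\bigl\|F(t/n)^{[ns]}f-f_n\bigr\|=0$$ and such that $(F'(0)f_n)_{n\ge 1}$ is a bounded sequence. Here $[x]$ denotes the integer part of $x$. -/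

import Mathlib

open Filter Topology
open scoped NNReal

section OperatorFamilies

variable {𝕜 E : Type*} [RCLike 𝕜] [NormedAddCommGroup E] [NormedSpace 𝕜 E]

/-- `y = lim_{h ↓ 0} h⁻¹ (S(h) x - S(0) x)` in norm, for `S : [0, ∞) → 𝓛(E)`. -/
def HasStrongDerivZero (S : ℝ≥0 → E →L[𝕜] E) (x y : E) : Prop :=
  Tendsto (fun h : ℝ≥0 => (((h : ℝ) : 𝕜)⁻¹) • (S h x - S 0 x)) (𝓝[>] (0 : ℝ≥0)) (𝓝 y)

theorem HasStrongDerivZero.unique {S : ℝ≥0 → E →L[𝕜] E} {x y z : E}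
    (hy : HasStrongDerivZero S x y) (hz : HasStrongDerivZero S x z) : y = z :=
  tendsto_nhds_unique hy hz

theorem HasStrongDerivZero.add {S : ℝ≥0 → E →L[𝕜] E} {x y x' y' : E}
    (h : HasStrongDerivZero S x y) (h' : HasStrongDerivZero S x' y') :
    HasStrongDerivZero S (x + x') (y + y') := by
  refine (Tendsto.add h h').congr fun r => ?_
  rw [← smul_add, map_add, map_add, add_sub_add_comm]

theorem HasStrongDerivZero.smul {S : ℝ≥0 → E →L[𝕜] E} {x y : E} (c : 𝕜)
    (h : HasStrongDerivZero S x y) : HasStrongDerivZero S (c • x) (c • y) := by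
  refine (Tendsto.const_smul h c).congr fun r => ?_
  rw [map_smul, map_smul, ← smul_sub, smul_comm]

theorem hasStrongDerivZero_zero (S : ℝ≥0 → E →L[𝕜] E) : HasStrongDerivZero S 0 0 := by
  simp [HasStrongDerivZero]

/-- The strong derivative `S'(0)`, as an unbounded operator whose domain `D(S'(0))` is the space of
all `x` for which the limit of the difference quotients exists. -/
noncomputable def strongDerivZero (S : ℝ≥0 → E →L[𝕜] E) : E →ₗ.[𝕜] E where
  domain :=
    { carrier := {x | ∃ y, HasStrongDerivZero S x y}
      add_mem' := fun ⟨_, h⟩ ⟨_, h'⟩ => ⟨_, h.add h'⟩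
      zero_mem' := ⟨0, hasStrongDerivZero_zero S⟩
      smul_mem' := fun c _ ⟨_, h⟩ => ⟨_, h.smul c⟩ }
  toFun :=
    { toFun := fun x => x.2.choose
      map_add' := fun x y =>
        (x + y).2.choose_spec.unique (x.2.choose_spec.add y.2.choose_spec)
      map_smul' := fun c x => (c • x).2.choose_spec.unique (x.2.choose_spec.smul c) }

theorem mem_strongDerivZero_domain {S : ℝ≥0 → E →L[𝕜] E} {x : E} :
    x ∈ (strongDerivZero S).domain ↔ ∃ y, HasStrongDerivZero S x y :=
  Iff.rfl

theorem hasStrongDerivZero_apply (S : ℝ≥0 → E →L[𝕜] E) (x : (strongDerivZero S).domain) :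
    HasStrongDerivZero S (x : E) (strongDerivZero S x) :=
  x.2.choose_spec

/-- `F(0) = I` and there are `a ∈ ℝ`, `M ≥ 1` with `‖F(s/n)^m‖ ≤ M exp(a s m / n)` for all natural
`n ≥ 1`, `m` and all `s ≥ 0`. -/
def ChernoffStable (F : ℝ≥0 → E →L[𝕜] E) : Prop :=
  F 0 = 1 ∧ ∃ a M : ℝ, 1 ≤ M ∧ ∀ n m : ℕ, 0 < n → ∀ s : ℝ≥0,
    ‖F (s / n) ^ m‖ ≤ M * Real.exp (a * s * (m / n))

/-- `C₀`-semigroups of operators on `E`. -/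
structure IsC0Semigroup (T : ℝ≥0 → E →L[𝕜] E) : Prop where
  map_zero : T 0 = 1
  map_add : ∀ l m : ℝ≥0, T (l + m) = T l * T m
  continuous : ∀ x : E, Continuous fun s => T s x
  bound : ∃ M a : ℝ, 1 < M ∧ ∀ s : ℝ≥0, ‖T s‖ ≤ M * Real.exp (a * s)

/-- `A` is the generator of some `C₀`-semigroup; equality includes equality of domains. -/
def IsC0Generator (A : E →ₗ.[𝕜] E) : Prop :=
  ∃ T : ℝ≥0 → E →L[𝕜] E, IsC0Semigroup T ∧ A = strongDerivZero T

/-- The function `F^*`, `F^*(s) = F(s)^*`, acting by `φ ↦ φ ∘ F(s)` on the dual space. -/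
noncomputable def dualFamily (F : ℝ≥0 → E →L[𝕜] E) :
    ℝ≥0 → StrongDual 𝕜 E →L[𝕜] StrongDual 𝕜 E :=
  fun s => ContinuousLinearMap.precomp 𝕜 (F s)

/-- Density of a set of functionals in the weak-* topology of the dual space. -/
def WeakStarDense (D : Set (StrongDual 𝕜 E)) : Prop :=
  Dense (StrongDual.toWeakDual '' D : Set (WeakDual 𝕜 E))

end OperatorFamilies

section Spaces

variable (𝕜 B : Type*) [RCLike 𝕜] [NormedAddCommGroup B] [inst : NormedSpace 𝕜 B]

/-- Reflexivity: the canonical embedding into the bidual is onto. -/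
def IsReflexiveSpace : Prop :=
  Function.Surjective (NormedSpace.inclusionInDoubleDual 𝕜 B)

/-- The given norm of `B` comes from an inner product. (Together with completeness: `B` is a
Hilbert space.) -/
def HasHilbertNorm : Prop :=
  ∃ ip : InnerProductSpace 𝕜 B, ip.toNormedSpace = inst

end Spaces

/-! Write `G n` for `F (t / n)` and Γ for the graph of `t • Z`. The scheme `G n ^ ⌊n s⌋` is stable
(`PowerBounded`) and consistent (`Consistent`): the difference quotients n (G n x - x) converge to y
for every (x, y) in Γ. The dual hypothesis supplies a separating family of pairs φ, ψ along which
the adjoint quotients converge in norm. Every such pair satisfies φ y = ψ x on the closure of Γ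
(`DualConsistent.apply_eq`). This makes Z closable, and it identifies weak limits.

Both directions use a Lax type principle, `Consistent.tendsto_pow_floor`: if v is a classical
solution of v' = w with (v, w) in the closure of Γ, the scheme started at v 0 converges strongly to
v. When the closure generates a semigroup T, the orbit of any f in the domain of Z is such a
solution. So the scheme converges to T s f, which lies in the domain of the closure and is a
graph-norm limit of elements of the domain of Z. These are the required approximants, and A can be
the whole domain.

Conversely, reflexivity gives, along one ultrafilter, weak limits u s of the discrete orbits of f in
A. The graph-bounded approximants put u s in the domain of the closure, and the dual pairs bound the
second component locally uniformly in s and give (φ ∘ u)' = ψ ∘ u (`exists_isWeakOrbit`).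
Integration shows that (∫₀^η u, u η - f) lies in the closure of Γ
(`IsWeakOrbit.integral_mem_closure`). Hence the moving integral of u over [s, s + η] is a classical
solution, and the Lax principle turns weak into strong convergence at ∫₀^η u. The averages η⁻¹ ∫₀^η
u tend to f, so stability and density give strong convergence everywhere. The limit is a semigroup;
its generator contains the closure of Γ by a discrete Taylor estimate, and is contained in it by the
integrated equation, extended by density. -/

/-! ### Stability and consistency imply convergence to classical solutions. -/

section Discrete

variable {𝕜 B : Type*} [RCLike 𝕜] [NormedAddCommGroup B] [NormedSpace 𝕜 B]

/-- Uniform exponential bounds for the powers of a sequence of operators, where `G n` stands for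
a time step of length `1 / n`. -/
structure PowerBounded (G : ℕ → B →L[𝕜] B) (M b : ℝ) : Prop where
  one_le : 1 ≤ M
  nonneg : 0 ≤ b
  bound : ∀ n m : ℕ, 0 < n → ‖G n ^ m‖ ≤ M * Real.exp (b * (m / n))

theorem PowerBounded.norm_pow_le {G : ℕ → B →L[𝕜] B} {M b : ℝ} (h : PowerBounded G M b)
    {n m : ℕ} {s : ℝ} (hn : 0 < n) (hm : (m : ℝ) ≤ n * s) :
    ‖G n ^ m‖ ≤ M * Real.exp (b * s) := by
  have hn' : (0 : ℝ) < n := by exact_mod_cast hn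
  refine (h.bound n m hn).trans ?_
  have h1 := h.one_le
  have h2 := h.nonneg
  have h3 : (m : ℝ) / n ≤ s := by rw [div_le_iff₀ hn']; linarith
  gcongr

theorem PowerBounded.one_le_const {G : ℕ → B →L[𝕜] B} {M b : ℝ} (h : PowerBounded G M b)
    {s : ℝ} (hs : 0 ≤ s) : 1 ≤ M * Real.exp (b * s) := by
  have h1 := h.one_le
  have h2 : 1 ≤ Real.exp (b * s) := Real.one_le_exp (mul_nonneg h.nonneg hs)
  nlinarith

/-- Telescoping estimate for the powers of an operator along a sequence of points. -/
theorem norm_pow_sub_le_of_step (T : B →L[𝕜] B) (N : ℕ → ℕ) (hN : Monotone N) (p : ℕ → B)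
    {C r : ℝ} (m : ℕ) (hC : ∀ k ≤ N m, ‖T ^ k‖ ≤ C)
    (hp : ∀ j < m, ‖(T ^ (N (j + 1) - N j)) (p j) - p (j + 1)‖ ≤ r) :
    ‖(T ^ (N m - N 0)) (p 0) - p m‖ ≤ m * (C * r) := by
  have key : (T ^ (N m - N 0)) (p 0) - p m = ∑ j ∈ Finset.range m,
      (T ^ (N m - N (j + 1))) ((T ^ (N (j + 1) - N j)) (p j) - p (j + 1)) := by
    have h1 := Finset.sum_range_sub' (fun j => (T ^ (N m - N j)) (p j)) m
    simp only [Nat.sub_self, pow_zero, one_apply_eq_self] at h1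
    rw [← h1]
    refine Finset.sum_congr rfl fun j hj => ?_
    have hj' : N (j + 1) ≤ N m := hN (Finset.mem_range.1 hj)
    have hj2 : N j ≤ N (j + 1) := hN (Nat.le_succ j)
    rw [map_sub, ← mul_apply_eq_comp, ← pow_add]
    congr 4
    omega
  rw [key]
  refine (norm_sum_le_of_le (f := _) _ (n := fun _ => C * r) fun j hj => ?_).trans ?_
  · refine (ContinuousLinearMap.le_opNorm _ _).trans ?_
    have := hp j (Finset.mem_range.1 hj)
    have h2 := hC (N m - N (j + 1)) (Nat.sub_le _ _)
    have : 0 ≤ C := (norm_nonneg _).trans h2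
    gcongr
  · simp

theorem norm_pow_add_sub_pow_le (T : B →L[𝕜] B) {C : ℝ} (k j : ℕ)
    (hC : ∀ i ≤ k + j, ‖T ^ i‖ ≤ C) (x : B) :
    ‖(T ^ (k + j)) x - (T ^ k) x‖ ≤ j * (C * ‖T x - x‖) := by
  have key : (T ^ (k + j)) x - (T ^ k) x = ∑ i ∈ Finset.range j, (T ^ (k + i)) (T x - x) := by
    have h1 := Finset.sum_range_sub (fun i => (T ^ (k + i)) x) j
    simp only [add_zero] at h1
    rw [← h1]
    refine Finset.sum_congr rfl fun i _ => ?_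
    rw [map_sub, ← add_assoc, pow_succ, mul_apply_eq_comp]
  rw [key]
  refine (norm_sum_le_of_le (f := _) _ (n := fun _ => C * ‖T x - x‖) fun i hi => ?_).trans ?_
  · refine (ContinuousLinearMap.le_opNorm _ _).trans ?_
    have := hC (k + i) (by have := Finset.mem_range.1 hi; omega)
    gcongr
  · simp

variable [NormedSpace ℝ B] [IsScalarTower ℝ 𝕜 B]

/-- The telescoping runs along the segment from x to y. The local error at an interpolated point is
the convex combination of the errors at the two ends, so consistency is needed at two points only,
whatever the number of steps. -/
theorem norm_pow_sub_le_of_interpolation (T : B →L[𝕜] B) {C r : ℝ} {m : ℕ} (hm : 0 < m)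
    (hC : ∀ k ≤ m, ‖T ^ k‖ ≤ C) (x y : B)
    (hx : ‖T x - x - (m : ℝ)⁻¹ • (y - x)‖ ≤ r) (hy : ‖T y - y - (m : ℝ)⁻¹ • (y - x)‖ ≤ r) :
    ‖(T ^ m) x - y‖ ≤ m * (C * r) := by
  have hm' : (0 : ℝ) < m := by exact_mod_cast hm
  have h := norm_pow_sub_le_of_step T id monotone_id (r := r)
    (fun j => x + ((j : ℝ) / m) • (y - x)) m hC (fun j hj => ?_)
  · simpa [hm'.ne'] using h
  · simp only [id, Nat.add_sub_cancel_left, pow_one, map_add, map_sub,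
      ContinuousLinearMap.map_smul_of_tower]
    have hj' : (j : ℝ) / m ≤ 1 := by
      rw [div_le_one hm']; exact_mod_cast hj.le
    have hj0 : 0 ≤ (j : ℝ) / m := by positivity
    have e : T x + ((j : ℝ) / m) • (T y - T x) - (x + (((j + 1 : ℕ) : ℝ) / m) • (y - x))
        = (1 - (j : ℝ) / m) • (T x - x - (m : ℝ)⁻¹ • (y - x))
          + ((j : ℝ) / m) • (T y - y - (m : ℝ)⁻¹ • (y - x)) := by
      push_cast
      rw [add_div]
      simp only [div_eq_mul_inv]
      module
    rw [e]
    refine (norm_add_le _ _).trans ?_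
    rw [norm_smul, norm_smul, Real.norm_of_nonneg (by linarith), Real.norm_of_nonneg hj0]
    calc _ ≤ (1 - (j : ℝ) / m) * r + ((j : ℝ) / m) * r := by gcongr
      _ = r := by ring

/-- The difference quotients of the steps `G n` converge along the relation `Γ`. -/
def Consistent (G : ℕ → B →L[𝕜] B) (Γ : Set (B × B)) : Prop :=
  ∀ p ∈ Γ, Tendsto (fun n : ℕ => (n : ℝ) • (G n p.1 - p.1)) atTop (𝓝 p.2)

/-- Consistency is known on Γ only, so p and q are replaced by nearby p' and q' in Γ, which are then
joined by interpolation. The constant is 12 from interpolation, 1 for moving p to p' and 1 for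
moving q' to q. -/
theorem Consistent.eventually_norm_pow_sub_le {G : ℕ → B →L[𝕜] B} {Γ : Set (B × B)}
    (hG : Consistent G Γ) {p q : B × B} (hp : p ∈ closure Γ) (hq : q ∈ closure Γ)
    {δ ε C : ℝ} (hδ : 0 < δ) (hε : 0 < ε) (hC : 1 ≤ C)
    (h₁ : ‖q.1 - p.1 - δ • p.2‖ ≤ ε * δ) (h₂ : ‖q.2 - p.2‖ ≤ ε)
    {m : ℕ → ℕ} (hm : Tendsto (fun n => (m n : ℝ) / n) atTop (𝓝 δ))
    (hCm : ∀ᶠ n in atTop, ∀ k ≤ m n, ‖G n ^ k‖ ≤ C) :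
    ∀ᶠ n in atTop, ‖(G n ^ m n) p.1 - q.1‖ ≤ 14 * C * (ε * δ) := by
  have hεδ : 0 < ε * δ := mul_pos hε hδ
  -- First components must be close to order ε δ, since their difference is divided by δ; second
  -- components only to order ε.
  have hmin : 0 < min ε (ε * δ) := lt_min hε hεδ
  obtain ⟨p', hp', hpp⟩ := Metric.mem_closure_iff.1 hp _ hmin
  obtain ⟨q', hq', hqq⟩ := Metric.mem_closure_iff.1 hq _ hmin
  rw [dist_comm, dist_eq_norm, Prod.norm_def, max_lt_iff, lt_min_iff, lt_min_iff] at hpp hqq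
  obtain ⟨⟨-, hp1⟩, ⟨hp2, -⟩⟩ := hpp
  obtain ⟨⟨-, hq1⟩, ⟨hq2, -⟩⟩ := hqq
  simp only [Prod.fst_sub, Prod.snd_sub] at hp1 hp2 hq1 hq2
  have hslope : ‖p.2 - δ⁻¹ • (q'.1 - p'.1)‖ < 3 * ε := by
    have e : p.2 - δ⁻¹ • (q'.1 - p'.1)
        = -(δ⁻¹ • ((q.1 - p.1 - δ • p.2) + (q'.1 - q.1) - (p'.1 - p.1))) := by
      rw [← sub_eq_zero]
      have : p.2 = δ⁻¹ • δ • p.2 := by rw [inv_smul_smul₀ hδ.ne']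
      nth_rw 1 [this]
      module
    have h3 : ‖(q.1 - p.1 - δ • p.2) + (q'.1 - q.1) - (p'.1 - p.1)‖ < 3 * ε * δ := by
      refine (norm_sub_le _ _).trans_lt ?_
      have := norm_add_le (q.1 - p.1 - δ • p.2) (q'.1 - q.1)
      linarith
    rw [e, norm_neg, norm_smul, norm_inv, Real.norm_of_nonneg hδ.le, inv_mul_lt_iff₀ hδ]
    linarith
  have hlim : Tendsto (fun n : ℕ => ((m n : ℝ) / n)⁻¹ • (q'.1 - p'.1)) atTop
      (𝓝 (δ⁻¹ • (q'.1 - p'.1))) := (hm.inv₀ hδ.ne').smul_const _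
  have hlp := ((hG p' hp').sub hlim).norm
  have hlq := ((hG q' hq').sub hlim).norm
  -- The triangle inequality gives 4 ε here and 5 ε for q'; the common bound 6 ε serves both.
  have bp : ‖p'.2 - δ⁻¹ • (q'.1 - p'.1)‖ < 6 * ε := by
    have e : p'.2 - δ⁻¹ • (q'.1 - p'.1) = (p'.2 - p.2) + (p.2 - δ⁻¹ • (q'.1 - p'.1)) := by abel
    rw [e]
    refine (norm_add_le _ _).trans_lt ?_
    linarith
  have bq : ‖q'.2 - δ⁻¹ • (q'.1 - p'.1)‖ < 6 * ε := by
    have e : q'.2 - δ⁻¹ • (q'.1 - p'.1)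
      = (q'.2 - q.2) + (q.2 - p.2) + (p.2 - δ⁻¹ • (q'.1 - p'.1)) := by abel
    rw [e]
    refine (norm_add₃_le).trans_lt ?_
    linarith
  filter_upwards [hCm, hlp.eventually_lt_const bp, hlq.eventually_lt_const bq,
    hm.eventually_lt_const (show δ < 2 * δ by linarith), hm.eventually_const_lt hδ,
    eventually_gt_atTop 0] with n hCn hpn hqn hm2 hm0 hn
  have hn' : (0 : ℝ) < n := by exact_mod_cast hn
  have hmn' : (0 : ℝ) < m n := by
    by_contra hcon
    have : (m n : ℝ) = 0 := le_antisymm (not_lt.1 hcon) (by positivity)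
    simp [this] at hm0
  have aux : ∀ z : B, (n : ℝ) • z - ((m n : ℝ) / n)⁻¹ • (q'.1 - p'.1)
      = (n : ℝ) • (z - (m n : ℝ)⁻¹ • (q'.1 - p'.1)) := by
    intro z
    rw [smul_sub (n : ℝ) z, smul_smul, inv_div, div_eq_mul_inv]
  rw [aux, norm_smul, Real.norm_of_nonneg hn'.le] at hpn hqn
  have main := norm_pow_sub_le_of_interpolation (G n) (r := 6 * ε / n)
    (by exact_mod_cast hmn') hCn p'.1 q'.1
    (by rw [le_div_iff₀ hn']; linarith) (by rw [le_div_iff₀ hn']; linarith)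
  have main2 : ‖(G n ^ m n) p'.1 - q'.1‖ ≤ 12 * C * (ε * δ) := by
    refine main.trans ?_
    have : (m n : ℝ) * (C * (6 * ε / n)) = ((m n : ℝ) / n) * (6 * C * ε) := by ring
    rw [this]
    have h5 : ((m n : ℝ) / n) * (6 * C * ε) ≤ (2 * δ) * (6 * C * ε) := by gcongr
    linarith
  have e : (G n ^ m n) p.1 - q.1
      = ((G n ^ m n) p'.1 - q'.1) - (G n ^ m n) (p'.1 - p.1) + (q'.1 - q.1) := by
    rw [map_sub]; abel
  have h6 : ‖(G n ^ m n) (p'.1 - p.1)‖ ≤ C * (ε * δ) := by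
    refine (ContinuousLinearMap.le_opNorm _ _).trans ?_
    have := hCn (m n) le_rfl
    gcongr
  rw [e]
  refine (norm_add_le _ _).trans ?_
  have := norm_sub_le ((G n ^ m n) p'.1 - q'.1) ((G n ^ m n) (p'.1 - p.1))
  nlinarith

theorem tendsto_floor_mul_div (s : ℝ) (hs : 0 ≤ s) :
    Tendsto (fun n : ℕ => (⌊(n : ℝ) * s⌋₊ : ℝ) / n) atTop (𝓝 s) := by
  have := (tendsto_nat_floor_mul_div_atTop (R := ℝ) hs).comp tendsto_natCast_atTop_atTop
  simpa [Function.comp_def, mul_comm] using this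

/-- Stability and consistency give convergence to classical solutions `v' = w`, `(v, w) ∈ Γ`. -/
theorem Consistent.tendsto_pow_floor {G : ℕ → B →L[𝕜] B} {Γ : Set (B × B)} {M b : ℝ}
    (hG : Consistent G Γ) (hb : PowerBounded G M b) {S : ℝ} (hS : 0 ≤ S) (v w : ℝ → B)
    (hΓ : ∀ s, 0 ≤ s → (v s, w s) ∈ closure Γ)
    (hv : ∀ ε > 0, ∃ δ > 0, ∀ s h, 0 ≤ s → 0 ≤ h → h ≤ δ → s + h ≤ S →
      ‖v (s + h) - v s - h • w s‖ ≤ ε * h ∧ ‖w (s + h) - w s‖ ≤ ε) :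
    Tendsto (fun n : ℕ => (G n ^ ⌊(n : ℝ) * S⌋₊) (v 0)) atTop (𝓝 (v S)) := by
  rcases hS.eq_or_lt with rfl | hS
  · simp
  set C := M * Real.exp (b * S) with hCdef
  have hC : 1 ≤ C := hb.one_le_const hS.le
  rw [Metric.tendsto_atTop']
  suffices h : ∀ ε > 0, ∀ᶠ n : ℕ in atTop,
      ‖(G n ^ ⌊(n : ℝ) * S⌋₊) (v 0) - v S‖ ≤ 14 * C ^ 2 * S * ε by
    intro ε hε
    have hpos : 0 < 14 * C ^ 2 * S := by positivity
    obtain ⟨N, hN⟩ := eventually_atTop.1 (h (ε / (14 * C ^ 2 * S) / 2) (by positivity))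
    refine ⟨N, fun n hn => ?_⟩
    rw [dist_eq_norm]
    refine (hN n hn.le).trans_lt ?_
    have : 14 * C ^ 2 * S * (ε / (14 * C ^ 2 * S) / 2) = ε / 2 := by field_simp
    rw [this]; linarith
  intro ε hε
  obtain ⟨δ₀, hδ₀, hstep⟩ := hv ε hε
  obtain ⟨K, hK⟩ := exists_nat_gt (S / δ₀)
  have hK0 : (0 : ℝ) < K := (div_pos hS hδ₀).trans hK
  set δ := S / K with hδdef
  have hδ : 0 < δ := div_pos hS hK0
  have hKδ : K * δ = S := by rw [hδdef]; field_simp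
  have hδle : δ ≤ δ₀ := by
    rw [div_lt_iff₀ hδ₀] at hK
    rw [hδdef, div_le_iff₀ hK0]; linarith
  have hmono : ∀ n : ℕ, Monotone fun j : ℕ => ⌊(n : ℝ) * (j * δ)⌋₊ := by
    intro n i j hij
    have : (i : ℝ) ≤ j := by exact_mod_cast hij
    exact Nat.floor_le_floor (by gcongr)
  have hbd : ∀ᶠ n : ℕ in atTop, ∀ k ≤ ⌊(n : ℝ) * (K * δ)⌋₊, ‖G n ^ k‖ ≤ C := by
    filter_upwards [eventually_gt_atTop 0] with n hn k hk
    refine hb.norm_pow_le hn ?_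
    rw [← hKδ]
    exact (Nat.cast_le.2 hk).trans (Nat.floor_le (by positivity))
  have hsteps : ∀ᶠ n : ℕ in atTop, ∀ j ∈ Finset.range K,
      ‖(G n ^ (⌊(n : ℝ) * ((j + 1 : ℕ) * δ)⌋₊ - ⌊(n : ℝ) * (j * δ)⌋₊)) (v (j * δ))
        - v ((j + 1 : ℕ) * δ)‖ ≤ 14 * C * (ε * δ) := by
    rw [Filter.eventually_all_finset]
    intro j hj
    have hj1 : ((j + 1 : ℕ) : ℝ) ≤ K := by exact_mod_cast Finset.mem_range.1 hj
    have hsum : ((j + 1 : ℕ) : ℝ) * δ = j * δ + δ := by push_cast; ring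
    have hst := hstep (j * δ) δ (by positivity) hδ.le hδle
      (by rw [← hsum, ← hKδ]; gcongr)
    rw [← hsum] at hst
    refine hG.eventually_norm_pow_sub_le (p := (v (j * δ), w (j * δ)))
      (q := (v ((j + 1 : ℕ) * δ), w ((j + 1 : ℕ) * δ)))
      (hΓ _ (by positivity)) (hΓ _ (by positivity)) hδ hε hC hst.1 hst.2 ?_ ?_
    · have h1 := (tendsto_floor_mul_div (((j + 1 : ℕ) : ℝ) * δ) (by positivity)).sub
        (tendsto_floor_mul_div ((j : ℝ) * δ) (by positivity))
      rw [hsum, add_sub_cancel_left] at h1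
      refine h1.congr fun n => ?_
      rw [← sub_div, Nat.cast_sub (hmono n (Nat.le_succ j)), ← hsum]
    · filter_upwards [hbd] with n hn k hk
      exact hn k ((hk.trans (Nat.sub_le _ _)).trans (hmono n (Finset.mem_range.1 hj)))
  filter_upwards [hbd, hsteps] with n hn hs
  have := norm_pow_sub_le_of_step (G n) (fun j : ℕ => ⌊(n : ℝ) * (j * δ)⌋₊) (hmono n)
    (fun j => v (j * δ)) K hn (r := 14 * C * (ε * δ))
    (fun j hj => hs j (Finset.mem_range.2 hj))
  simp only [Nat.cast_zero, zero_mul, mul_zero, Nat.floor_zero, Nat.sub_zero, hKδ] at this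
  refine this.trans (le_of_eq ?_)
  rw [← hKδ]; ring

end Discrete

/-! ### Weak limits, reflexivity and weak-* density. -/

section Weak

variable {𝕜 E B : Type*} [RCLike 𝕜] [NormedAddCommGroup E] [NormedSpace 𝕜 E]
  [NormedAddCommGroup B] [NormedSpace 𝕜 B]

/-- Bounded sequences in a reflexive space converge weakly along ultrafilters. -/
theorem IsReflexiveSpace.exists_weak_limit (hR : IsReflexiveSpace 𝕜 E) {ι : Type*}
    (U : Ultrafilter ι) (x : ι → E) {R : ℝ} (hx : ∀ᶠ n in U, ‖x n‖ ≤ R) :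
    ∃ y : E, ∀ φ : StrongDual 𝕜 E, Tendsto (fun n => φ (x n)) U (𝓝 (φ y)) := by
  let J : E → WeakDual 𝕜 (StrongDual 𝕜 E) := fun z =>
    StrongDual.toWeakDual (NormedSpace.inclusionInDoubleDual 𝕜 E z)
  -- Banach–Alaoglu in the bidual; reflexivity then brings the limit back to `E`.
  obtain ⟨Φ, -, hΦ⟩ := (WeakDual.isCompact_closedBall (𝕜 := 𝕜) (E := StrongDual 𝕜 E) 0
    R).ultrafilter_le_nhds (U.map fun n => J (x n)) (by
      rw [le_principal_iff, Ultrafilter.mem_coe, Ultrafilter.mem_map, ← Ultrafilter.mem_coe]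
      filter_upwards [hx] with n hn
      simp only [Set.mem_preimage, mem_closedBall_zero_iff]
      exact (NormedSpace.double_dual_bound 𝕜 E (x n)).trans hn)
  obtain ⟨y, hy⟩ := hR (WeakDual.toStrongDual Φ)
  refine ⟨y, fun φ => ?_⟩
  have h1 : Tendsto (fun n => J (x n)) U (𝓝 Φ) := hΦ
  have h2 := ((WeakDual.eval_continuous φ).tendsto Φ).comp h1
  have h3 : φ y = Φ φ := by
    have := congrArg (fun Ψ : StrongDual 𝕜 (StrongDual 𝕜 E) => Ψ φ) hy
    simpa using this
  rw [h3]
  exact h2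

theorem norm_le_of_weak_limit {ι : Type*} {l : Filter ι} [l.NeBot] {x : ι → E} {y : E}
    (h : ∀ φ : StrongDual 𝕜 E, Tendsto (fun n => φ (x n)) l (𝓝 (φ y))) {r : ι → ℝ} {R : ℝ}
    (hx : ∀ᶠ n in l, ‖x n‖ ≤ r n) (hr : Tendsto r l (𝓝 R)) : ‖y‖ ≤ R := by
  have hR : 0 ≤ R := ge_of_tendsto hr (hx.mono fun n hn => (norm_nonneg _).trans hn)
  refine NormedSpace.norm_le_dual_bound 𝕜 y hR fun φ => ?_
  rw [mul_comm]
  refine le_of_tendsto_of_tendsto (h φ).norm (hr.const_mul ‖φ‖) ?_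
  filter_upwards [hx] with n hn
  exact (φ.le_opNorm _).trans (by gcongr)

/-- Closed subspaces are weakly closed. -/
theorem Submodule.mem_closure_of_weak_limit (Γ : Submodule 𝕜 E) {ι : Type*} {l : Filter ι}
    [l.NeBot] {x : ι → E} {y : E} (hx : ∀ᶠ n in l, x n ∈ closure (Γ : Set E))
    (h : ∀ φ : StrongDual 𝕜 E, Tendsto (fun n => φ (x n)) l (𝓝 (φ y))) :
    y ∈ closure (Γ : Set E) := by
  let _ : NormedSpace ℝ E := NormedSpace.restrictScalars ℝ 𝕜 E
  have : IsScalarTower ℝ 𝕜 E := RestrictScalars.isScalarTower ℝ 𝕜 E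
  by_contra hy
  have hconv : Convex ℝ (closure (Γ : Set E)) := (Γ.restrictScalars ℝ).convex.closure
  obtain ⟨f, u, hfu, hfb⟩ :=
    RCLike.geometric_hahn_banach_point_closed (𝕜 := 𝕜) hconv isClosed_closure hy
  have := ge_of_tendsto ((RCLike.continuous_re.tendsto _).comp (h f))
    (hx.mono fun n hn => (hfb _ hn).le)
  linarith

theorem Submodule.mk_mem_closure_of_weak_limit (Γ : Submodule 𝕜 (B × B)) {ι : Type*}
    {l : Filter ι} [l.NeBot] {p : ι → B × B} {x y : B}
    (hp : ∀ᶠ n in l, p n ∈ closure (Γ : Set (B × B)))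
    (hx : ∀ φ : StrongDual 𝕜 B, Tendsto (fun n => φ (p n).1) l (𝓝 (φ x)))
    (hy : ∀ φ : StrongDual 𝕜 B, Tendsto (fun n => φ (p n).2) l (𝓝 (φ y))) :
    (x, y) ∈ closure (Γ : Set (B × B)) := by
  refine Γ.mem_closure_of_weak_limit hp fun φ => ?_
  have key : ∀ q : B × B, φ q = (φ.comp (ContinuousLinearMap.inl 𝕜 B B)) q.1
      + (φ.comp (ContinuousLinearMap.inr 𝕜 B B)) q.2 := by
    intro q
    simp only [ContinuousLinearMap.comp_apply, ← map_add]
    simp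
  simp only [key _]
  exact (hx _).add (hy _)

theorem WeakStarDense.eq_zero {D : Set (StrongDual 𝕜 E)} (hD : WeakStarDense D) {y : E}
    (h : ∀ φ ∈ D, φ y = 0) : y = 0 := by
  refine SeparatingDual.eq_zero_of_forall_dual_eq_zero (R := 𝕜) fun φ => ?_
  have hc : IsClosed {Φ : WeakDual 𝕜 E | Φ y = 0} :=
    isClosed_eq (WeakDual.eval_continuous y) continuous_const
  have h1 : closure (StrongDual.toWeakDual '' D : Set (WeakDual 𝕜 E)) ⊆ {Φ | Φ y = 0} :=
    closure_minimal (by rintro _ ⟨φ, hφ, rfl⟩; exact h φ hφ) hc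
  exact h1 (hD (StrongDual.toWeakDual φ))

/-- Riesz representation is applied twice. As it is conjugate linear, Φ composed with it must be
conjugated to give a linear functional. -/
theorem isReflexiveSpace_of_innerProductSpace (H : Type*) [NormedAddCommGroup H]
    [InnerProductSpace 𝕜 H] [CompleteSpace H] : IsReflexiveSpace 𝕜 H := by
  intro Φ
  let d := InnerProductSpace.toDual 𝕜 H
  let ψ : StrongDual 𝕜 H := LinearMap.mkContinuous
    { toFun := fun y => (starRingEnd 𝕜) (Φ (d y))
      map_add' := fun a b => by simp
      map_smul' := fun c a => by simp [LinearIsometryEquiv.map_smulₛₗ d c a] } ‖Φ‖ (fun y => by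
        simpa using Φ.le_opNorm (d y))
  refine ⟨d.symm ψ, ?_⟩
  ext φ
  obtain ⟨y, rfl⟩ := d.surjective φ
  rw [NormedSpace.dual_def]
  have h1 : inner 𝕜 (d.symm ψ) y = ψ y := by
    simp only [d, InnerProductSpace.toDual_symm_apply]
  have h2 : d y (d.symm ψ) = inner 𝕜 y (d.symm ψ) := by
    simp only [d, InnerProductSpace.toDual_apply_apply]
  rw [h2, ← inner_conj_symm, h1]
  simp [ψ]

theorem HasHilbertNorm.isReflexiveSpace [CompleteSpace E] (h : HasHilbertNorm 𝕜 E) :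
    IsReflexiveSpace 𝕜 E := by
  obtain ⟨ip, rfl⟩ := h
  exact isReflexiveSpace_of_innerProductSpace E

end Weak

/-! ### Riemann sums of a derivative. -/

section Riemann

variable {E : Type*} [NormedAddCommGroup E] [NormedSpace ℝ E]

/-- Each of the N cells contributes an error L (η / N)², so the total is O(1 / N). This serves both
for the integral of u and for φ ∘ u with derivative ψ ∘ u. -/
theorem tendsto_riemann_sum {I g : ℝ → E} {L η : ℝ} (hη : 0 ≤ η)
    (h : ∀ a b, 0 ≤ a → a ≤ b → b ≤ η → ‖I b - I a - (b - a) • g a‖ ≤ L * (b - a) ^ 2) :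
    Tendsto (fun N : ℕ => (η / N) • ∑ i ∈ Finset.range N, g (i * (η / N))) atTop
      (𝓝 (I η - I 0)) := by
  rw [tendsto_iff_norm_sub_tendsto_zero]
  have hlim : Tendsto (fun N : ℕ => (L * η ^ 2) / (N : ℝ)) atTop (𝓝 0) :=
    tendsto_const_div_atTop_nhds_zero_nat _
  refine squeeze_zero' (Eventually.of_forall fun _ => norm_nonneg _) ?_ hlim
  filter_upwards [eventually_gt_atTop 0] with N hN
  have hN' : (0 : ℝ) < N := by exact_mod_cast hN
  have hNη : N * (η / N) = η := by field_simp
  have hδ : 0 ≤ η / N := by positivity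
  have htel : I η - I 0 = ∑ i ∈ Finset.range N,
      (I ((i + 1 : ℕ) * (η / N)) - I (i * (η / N))) := by
    rw [Finset.sum_range_sub (fun i : ℕ => I (i * (η / N)))]
    simp [hNη]
  rw [htel, Finset.smul_sum, ← Finset.sum_sub_distrib]
  refine (norm_sum_le_of_le (f := _) _ (n := fun _ => L * (η / N) ^ 2) fun i hi => ?_).trans ?_
  · have hi1 : ((i + 1 : ℕ) : ℝ) ≤ N := by exact_mod_cast Finset.mem_range.1 hi
    have hsum : ((i + 1 : ℕ) : ℝ) * (η / N) = i * (η / N) + η / N := by push_cast; ring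
    have h1 := h (i * (η / N)) ((i + 1 : ℕ) * (η / N)) (by positivity)
      (by rw [hsum]; linarith) (le_trans (by gcongr) hNη.le)
    rw [norm_sub_rev]
    have h2 : ((i + 1 : ℕ) : ℝ) * (η / N) - i * (η / N) = η / N := by rw [hsum]; ring
    rwa [h2] at h1
  · simp only [Finset.sum_const, Finset.card_range, nsmul_eq_mul]
    apply le_of_eq
    field_simp

end Riemann

/-! ### Weak limits of discrete orbits and their integrated equation. -/

section WeakOrbit

variable {𝕜 B : Type*} [RCLike 𝕜] [NormedAddCommGroup B] [NormedSpace 𝕜 B]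

/-- The difference quotients of the adjoint steps `(G n)^*` at `φ` converge to `ψ` in norm. -/
def DualConsistent (G : ℕ → B →L[𝕜] B) (φ ψ : StrongDual 𝕜 B) : Prop :=
  Tendsto (fun n : ℕ => (n : 𝕜) • (φ.comp (G n) - φ)) atTop (𝓝 ψ)

theorem floor_sub_floor_le {x y : ℝ} (hxy : x ≤ y) : (⌊y⌋₊ : ℝ) - ⌊x⌋₊ ≤ y - x + 1 := by
  rcases le_total 0 y with hy | hy
  · have := Nat.floor_le hy
    have := Nat.lt_floor_add_one x
    linarith
  · rw [Nat.floor_of_nonpos hy, Nat.floor_of_nonpos (hxy.trans hy)]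
    simp
    linarith

theorem PowerBounded.norm_pow_floor_le {G : ℕ → B →L[𝕜] B} {M b : ℝ} (h : PowerBounded G M b)
    {n : ℕ} {s S : ℝ} (hn : 0 < n) (hS : 0 ≤ S) (hs : s ≤ S) {k : ℕ} (hk : k ≤ ⌊(n : ℝ) * s⌋₊) :
    ‖G n ^ k‖ ≤ M * Real.exp (b * S) := by
  refine h.norm_pow_le hn ?_
  refine (Nat.cast_le.2 hk).trans ?_
  have h1 : (0 : ℝ) ≤ n * S := by positivity
  exact (Nat.cast_le.2 (Nat.floor_le_floor (by gcongr))).trans (Nat.floor_le h1)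

/-- A weak limit of the discrete orbits `G n ^ ⌊n s⌋ f`, with its regularity. -/
structure IsWeakOrbit (G : ℕ → B →L[𝕜] B) (Γ : Set (B × B)) (U : Ultrafilter ℕ) (f : B)
    (u : ℝ → B) : Prop where
  weak_limit : ∀ s, ∀ φ : StrongDual 𝕜 B,
    Tendsto (fun n : ℕ => φ ((G n ^ ⌊(n : ℝ) * s⌋₊) f)) U (𝓝 (φ (u s)))
  lipschitz : ∀ S, 0 ≤ S → ∃ L, 0 ≤ L ∧ ∀ s s', s ≤ s' → s' ≤ S → ‖u s' - u s‖ ≤ L * (s' - s)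
  mem_graph : ∀ S, 0 ≤ S → ∃ L, 0 ≤ L ∧ ∀ s, 0 ≤ s → s ≤ S → ∃ w, (u s, w) ∈ closure Γ ∧ ‖w‖ ≤ L
  weak_deriv : ∀ S, 0 ≤ S → ∀ φ ψ, DualConsistent G φ ψ → ∃ L, ∀ s s', 0 ≤ s → s ≤ s' →
    s' ≤ S → ‖φ (u s') - φ (u s) - (s' - s) • ψ (u s)‖ ≤ L * (s' - s) ^ 2

theorem IsWeakOrbit.zero {G : ℕ → B →L[𝕜] B} {Γ : Set (B × B)} {U : Ultrafilter ℕ} {f : B}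
    {u : ℝ → B} (h : IsWeakOrbit G Γ U f u) : u 0 = f := by
  rw [← sub_eq_zero]
  refine SeparatingDual.eq_zero_of_forall_dual_eq_zero (R := 𝕜) fun φ => ?_
  have := h.weak_limit 0 φ
  simp only [mul_zero, Nat.floor_zero, pow_zero, one_apply_eq_self] at this
  rw [map_sub, sub_eq_zero]
  exact tendsto_nhds_unique this tendsto_const_nhds

theorem IsWeakOrbit.continuous {G : ℕ → B →L[𝕜] B} {Γ : Set (B × B)} {U : Ultrafilter ℕ} {f : B}
    {u : ℝ → B} (h : IsWeakOrbit G Γ U f u) : Continuous u := by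
  rw [continuous_iff_continuousAt]
  intro s
  obtain ⟨L, hL, hu⟩ := h.lipschitz (|s| + 1) (by positivity)
  have hlip : LipschitzOnWith L.toNNReal u (Set.Iic (|s| + 1)) := by
    refine LipschitzOnWith.of_dist_le_mul fun x hx y hy => ?_
    rw [Real.coe_toNNReal _ hL, dist_eq_norm, Real.dist_eq]
    rcases le_total x y with hxy | hxy
    · rw [norm_sub_rev, abs_sub_comm, abs_of_nonneg (sub_nonneg.2 hxy)]
      exact hu x y hxy hy
    · rw [abs_of_nonneg (sub_nonneg.2 hxy)]
      exact hu y x hxy hx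
  exact hlip.continuousOn.continuousAt (Iic_mem_nhds (by linarith [le_abs_self s]))

variable [NormedSpace ℝ B]

theorem norm_pow_add_sub_pow_le' (T : B →L[𝕜] B) {C : ℝ} (k j : ℕ) {n : ℕ} (hn : 0 < n)
    (hC : ∀ i ≤ k + j, ‖T ^ i‖ ≤ C) (x : B) :
    ‖(T ^ (k + j)) x - (T ^ k) x‖ ≤ (j / n : ℝ) * (C * ‖(n : ℝ) • (T x - x)‖) := by
  refine (norm_pow_add_sub_pow_le T k j hC x).trans (le_of_eq ?_)
  have hn' : (0 : ℝ) < n := by exact_mod_cast hn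
  rw [norm_smul, Real.norm_of_nonneg hn'.le]
  field_simp

/-- Lipschitz estimate for the discrete orbits. -/
theorem PowerBounded.norm_orbit_sub_le {G : ℕ → B →L[𝕜] B} {M b : ℝ} (h : PowerBounded G M b)
    {n : ℕ} (hn : 0 < n) {s s' S : ℝ} (hS : 0 ≤ S) (hss : s ≤ s') (hs : s' ≤ S) (x : B) :
    ‖(G n ^ ⌊(n : ℝ) * s'⌋₊) x - (G n ^ ⌊(n : ℝ) * s⌋₊) x‖
      ≤ (s' - s + 1 / n) * (M * Real.exp (b * S) * ‖(n : ℝ) • (G n x - x)‖) := by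
  have hn' : (0 : ℝ) < n := by exact_mod_cast hn
  have hle : ⌊(n : ℝ) * s⌋₊ ≤ ⌊(n : ℝ) * s'⌋₊ := Nat.floor_le_floor (by gcongr)
  obtain ⟨j, hj⟩ := Nat.exists_eq_add_of_le hle
  have hC := h.one_le_const hS
  rw [hj]
  refine (norm_pow_add_sub_pow_le' (G n) _ j hn (C := M * Real.exp (b * S)) ?_ x).trans ?_
  · intro i hi
    rw [← hj] at hi
    exact h.norm_pow_floor_le hn hS hs hi
  · have h1 := floor_sub_floor_le (show (n : ℝ) * s ≤ n * s' by gcongr)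
    rw [hj] at h1
    push_cast at h1
    -- The extra 1 / n is the rounding error of the two floors; it disappears in the limit.
    have h2 : (j : ℝ) / n ≤ s' - s + 1 / n := by
      rw [div_le_iff₀ hn', add_mul, one_div, inv_mul_cancel₀ hn'.ne']
      linarith
    gcongr

/-- A discrete Taylor formula: each increment of φ is n⁻¹ χ at the current point, with χ the adjoint
quotient, and freezing that point at step k costs one more Lipschitz estimate. The square in the
remainder lets the limit be integrated by Riemann sums. -/
theorem norm_dual_pow_sub_le (G : ℕ → B →L[𝕜] B) (φ : StrongDual 𝕜 B) {n : ℕ} (hn : 0 < n)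
    (k j : ℕ) {C : ℝ} (hC : ∀ i ≤ k + j, ‖G n ^ i‖ ≤ C) (x : B) :
    ‖φ ((G n ^ (k + j)) x) - φ ((G n ^ k) x)
        - ((j / n : ℝ) : 𝕜) * ((n : 𝕜) • (φ.comp (G n) - φ)) ((G n ^ k) x)‖
      ≤ (j / n : ℝ) ^ 2 * (‖(n : 𝕜) • (φ.comp (G n) - φ)‖ * (C * ‖(n : ℝ) • (G n x - x)‖)) := by
  have hn' : (0 : ℝ) < n := by exact_mod_cast hn
  have hn'' : (n : 𝕜) ≠ 0 := by exact_mod_cast hn.ne'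
  set χ := (n : 𝕜) • (φ.comp (G n) - φ) with hχ
  have hstep : ∀ y, φ (G n y) - φ y = (n : 𝕜)⁻¹ * χ y := by
    intro y
    simp [hχ, hn'']
  have hsum : φ ((G n ^ (k + j)) x) - φ ((G n ^ k) x)
      = ∑ i ∈ Finset.range j, (n : 𝕜)⁻¹ * χ ((G n ^ (k + i)) x) := by
    have h1 := Finset.sum_range_sub (fun i => φ ((G n ^ (k + i)) x)) j
    simp only [add_zero] at h1
    rw [← h1]
    refine Finset.sum_congr rfl fun i _ => ?_
    rw [← hstep, ← mul_apply_eq_comp, ← pow_succ', add_assoc]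
  have hconst : ((j / n : ℝ) : 𝕜) * χ ((G n ^ k) x)
      = ∑ i ∈ Finset.range j, (n : 𝕜)⁻¹ * χ ((G n ^ k) x) := by
    rw [Finset.sum_const, Finset.card_range, nsmul_eq_mul]
    push_cast
    ring
  rw [hsum, hconst, ← Finset.sum_sub_distrib]
  refine (norm_sum_le_of_le (f := _) _
    (n := fun _ => (n : ℝ)⁻¹ * (‖χ‖ * ((j / n : ℝ) * (C * ‖(n : ℝ) • (G n x - x)‖))))
    fun i hi => ?_).trans ?_
  · have hij : i ≤ j := (Finset.mem_range.1 hi).le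
    rw [← mul_sub, ← map_sub, norm_mul, norm_inv, RCLike.norm_natCast]
    have h1 := norm_pow_add_sub_pow_le' (G n) k i hn (fun l hl => hC l (by omega)) x
    have hC0 : 0 ≤ C := (norm_nonneg _).trans (hC 0 (by omega))
    have hij' : (i : ℝ) ≤ j := by exact_mod_cast hij
    refine mul_le_mul_of_nonneg_left ((χ.le_opNorm _).trans ?_) (by positivity)
    refine mul_le_mul_of_nonneg_left (h1.trans ?_) (norm_nonneg _)
    gcongr
  · rw [Finset.sum_const, Finset.card_range, nsmul_eq_mul]
    apply le_of_eq
    ring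

variable [IsScalarTower ℝ 𝕜 B]

/-- On Γ both sides are limits of n φ (G n x - x), read once through the quotient of the operator
and once through that of its adjoint. The identity is a closed condition. -/
theorem DualConsistent.apply_eq {G : ℕ → B →L[𝕜] B} {Γ : Set (B × B)} (hG : Consistent G Γ)
    {φ ψ : StrongDual 𝕜 B} (h : DualConsistent G φ ψ) {p : B × B} (hp : p ∈ closure Γ) :
    φ p.2 = ψ p.1 := by
  have hc : IsClosed {p : B × B | φ p.2 = ψ p.1} := isClosed_eq (by fun_prop) (by fun_prop)
  refine closure_minimal (fun q hq => ?_) hc hp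
  have h1 := (φ.continuous.tendsto _).comp (hG q hq)
  have h2 := ((ContinuousLinearMap.apply 𝕜 𝕜 q.1).continuous.tendsto _).comp h
  refine tendsto_nhds_unique h1 (h2.congr fun n => ?_)
  simp [ContinuousLinearMap.map_smul_of_tower, RCLike.real_smul_eq_coe_mul]

theorem dual_steps_apply (G : ℕ → B →L[𝕜] B) (φ : StrongDual 𝕜 B) (n k : ℕ) (x : B) :
    ((n : 𝕜) • (φ.comp (G n) - φ)) ((G n ^ k) x)
      = φ ((G n ^ k) ((n : ℝ) • (G n x - x))) := by
  have : G n ((G n ^ k) x) = (G n ^ k) (G n x) := by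
    rw [← mul_apply_eq_comp, ← mul_apply_eq_comp, ← pow_succ, ← pow_succ']
  rw [ContinuousLinearMap.map_smul_of_tower, ContinuousLinearMap.map_smul_of_tower, map_sub,
    ← this, map_sub, RCLike.real_smul_eq_coe_mul, RCLike.ofReal_natCast]
  rfl

theorem exists_isWeakOrbit (hR : IsReflexiveSpace 𝕜 B) {G : ℕ → B →L[𝕜] B}
    {Γ : Submodule 𝕜 (B × B)} {M b : ℝ} (hb : PowerBounded G M b) (hG : Consistent G (Γ : Set (B × B)))
    (hsep : ∀ y, (∀ φ ψ, DualConsistent G φ ψ → φ y = 0) → y = 0)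
    {U : Ultrafilter ℕ} (hU : (U : Filter ℕ) ≤ atTop) {f z : B} (hf : (f, z) ∈ Γ)
    (happ : ∀ s : ℝ, 0 ≤ s → ∃ q : ℕ → B × B, (∀ n, q n ∈ Γ) ∧
      Tendsto (fun n : ℕ => (G n ^ ⌊(n : ℝ) * s⌋₊) f - (q n).1) atTop (𝓝 0) ∧
      ∃ R, ∀ n, ‖(q n).2‖ ≤ R) :
    ∃ u, IsWeakOrbit G (Γ : Set (B × B)) U f u := by
  have hpos : ∀ᶠ n : ℕ in U, 0 < n := hU (eventually_gt_atTop 0)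
  have hA : Tendsto (fun n : ℕ => ‖(n : ℝ) • (G n f - f)‖) U (𝓝 ‖z‖) :=
    ((hG _ hf).mono_left hU).norm
  have hinv : Tendsto (fun n : ℕ => 1 / (n : ℝ)) U (𝓝 0) :=
    tendsto_one_div_atTop_nhds_zero_nat.mono_left hU
  have hbdd : ∀ S, 0 ≤ S → ∀ s ≤ S, ∀ g : ℕ → B, ∀ᶠ n in U,
      ‖(G n ^ ⌊(n : ℝ) * s⌋₊) (g n)‖ ≤ M * Real.exp (b * S) * ‖g n‖ := by
    intro S hS s hs g
    filter_upwards [hpos] with n hn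
    refine (ContinuousLinearMap.le_opNorm _ _).trans ?_
    have := hb.norm_pow_floor_le hn hS hs le_rfl
    gcongr
  have hex : ∀ s : ℝ, ∃ y : B, ∀ φ : StrongDual 𝕜 B,
      Tendsto (fun n : ℕ => φ ((G n ^ ⌊(n : ℝ) * s⌋₊) f)) U (𝓝 (φ y)) := fun s =>
    hR.exists_weak_limit U _ (hbdd |s| (abs_nonneg s) s (le_abs_self s) fun _ => f)
  choose u hu using hex
  -- The functionals converge in norm while the orbit is bounded and converges weakly, so the
  -- pairing converges.
  have hchi : ∀ S, 0 ≤ S → ∀ s ≤ S, ∀ φ ψ, DualConsistent G φ ψ →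
      Tendsto (fun n : ℕ => ((n : 𝕜) • (φ.comp (G n) - φ)) ((G n ^ ⌊(n : ℝ) * s⌋₊) f)) U
        (𝓝 (ψ (u s))) := by
    intro S hS s hs φ ψ hφ
    have hd : Tendsto (fun n : ℕ => ‖(n : 𝕜) • (φ.comp (G n) - φ) - ψ‖
        * (M * Real.exp (b * S) * ‖f‖)) U (𝓝 (0 * (M * Real.exp (b * S) * ‖f‖))) :=
      ((tendsto_iff_norm_sub_tendsto_zero.1 hφ).mono_left hU).mul_const _
    rw [zero_mul] at hd
    have h0 : Tendsto (fun n : ℕ => ((n : 𝕜) • (φ.comp (G n) - φ) - ψ)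
        ((G n ^ ⌊(n : ℝ) * s⌋₊) f)) U (𝓝 0) := by
      refine squeeze_zero_norm' ?_ hd
      filter_upwards [hbdd S hS s hs fun _ => f] with n hn
      exact (ContinuousLinearMap.le_opNorm _ _).trans (by gcongr)
    have h1 := h0.add (hu s ψ)
    rw [zero_add] at h1
    refine h1.congr fun n => ?_
    rw [_root_.sub_apply, sub_add_cancel]
  refine ⟨u, hu, fun S hS => ?_, fun S hS => ?_, fun S hS φ ψ hφ => ?_⟩
  · have hC := hb.one_le_const hS
    refine ⟨M * Real.exp (b * S) * ‖z‖, by positivity, fun s s' hss hs => ?_⟩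
    have hlim : Tendsto (fun n : ℕ => (s' - s + 1 / (n : ℝ))
        * (M * Real.exp (b * S) * ‖(n : ℝ) • (G n f - f)‖)) U
        (𝓝 ((s' - s + 0) * (M * Real.exp (b * S) * ‖z‖))) :=
      (hinv.const_add _).mul (hA.const_mul _)
    rw [add_zero, mul_comm (s' - s)] at hlim
    refine norm_le_of_weak_limit (𝕜 := 𝕜) (l := (U : Filter ℕ))
      (x := fun n : ℕ => (G n ^ ⌊(n : ℝ) * s'⌋₊) f - (G n ^ ⌊(n : ℝ) * s⌋₊) f) (fun φ => ?_) ?_ hlim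
    · simp only [map_sub]
      exact (hu s' φ).sub (hu s φ)
    · filter_upwards [hpos] with n hn
      exact hb.norm_orbit_sub_le hn hS hss hs f
  · have hC := hb.one_le_const hS
    refine ⟨M * Real.exp (b * S) * ‖z‖, by positivity, fun s hs0 hs => ?_⟩
    obtain ⟨q, hqΓ, hq, R, hqR⟩ := happ s hs0
    obtain ⟨w, hw⟩ := hR.exists_weak_limit U (fun n => (q n).2) (Eventually.of_forall hqR)
    have hmem : (u s, w) ∈ closure (Γ : Set (B × B)) := by
      refine Γ.mk_mem_closure_of_weak_limit (l := (U : Filter ℕ))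
        (Eventually.of_forall fun n => subset_closure (hqΓ n)) (fun φ => ?_) hw
      have h1 := (hu s φ).sub ((φ.continuous.tendsto 0).comp (hq.mono_left hU))
      rw [map_zero, sub_zero] at h1
      refine h1.congr fun n => ?_
      simp
    have hAf : ∀ᶠ n : ℕ in U, ‖(n : ℝ) • (G n f - f)‖ ≤ ‖z‖ + 1 :=
      (hA.eventually_lt_const (lt_add_one ‖z‖)).mono fun _ h => h.le
    have hbz := hbdd S hS s hs fun n => (n : ℝ) • (G n f - f)
    -- The bound on the approximants depends on s in an unknown way. The quotients transported along
    -- the orbit have a bound uniform for s ≤ S, so their weak limit w' is introduced and shown to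
    -- equal w.
    obtain ⟨w', hw'⟩ := hR.exists_weak_limit U
      (fun n : ℕ => (G n ^ ⌊(n : ℝ) * s⌋₊) ((n : ℝ) • (G n f - f)))
      (R := M * Real.exp (b * S) * (‖z‖ + 1)) (by
        filter_upwards [hAf, hbz] with n h1 h2
        exact h2.trans (by gcongr))
    -- Powers of `G n` commute with its quotient, so φ w' is the limit of adjoint quotients on the
    -- orbit, namely ψ (u s), which is also φ w.
    have hww : w' = w := by
      rw [← sub_eq_zero]
      refine hsep _ fun φ ψ hφ => ?_
      rw [map_sub, sub_eq_zero, hφ.apply_eq hG hmem]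
      refine tendsto_nhds_unique (hw' φ) ?_
      simp only [← dual_steps_apply]
      exact hchi S hS s hs φ ψ hφ
    refine ⟨w, hmem, ?_⟩
    rw [← hww]
    exact norm_le_of_weak_limit hw' hbz (hA.const_mul _)
  · refine ⟨‖ψ‖ * (M * Real.exp (b * S) * ‖z‖), fun s s' hs0 hss hs => ?_⟩
    have hj : Tendsto (fun n : ℕ => (((⌊(n : ℝ) * s'⌋₊ - ⌊(n : ℝ) * s⌋₊ : ℕ) : ℝ) / n)) U
        (𝓝 (s' - s)) := by
      refine Tendsto.congr (fun n => ?_) (((tendsto_floor_mul_div s' (hs0.trans hss)).sub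
        (tendsto_floor_mul_div s hs0)).mono_left hU)
      rw [← sub_div, Nat.cast_sub (Nat.floor_le_floor (by gcongr))]
    have hl := (((hu s' φ).sub (hu s φ)).sub
      (((RCLike.continuous_ofReal (K := 𝕜)).tendsto _).comp hj |>.mul
        (hchi S hS s (hss.trans hs) φ ψ hφ))).norm
    have hr := (hj.pow 2).mul (((hφ.mono_left hU).norm).mul (hA.const_mul (M * Real.exp (b * S))))
    rw [RCLike.real_smul_eq_coe_mul, mul_comm (_ * _) ((s' - s) ^ 2)]
    refine le_of_tendsto_of_tendsto hl hr ?_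
    filter_upwards [hpos] with n hn
    have hle : ⌊(n : ℝ) * s⌋₊ ≤ ⌊(n : ℝ) * s'⌋₊ := Nat.floor_le_floor (by gcongr)
    have h1 := norm_dual_pow_sub_le G φ hn ⌊(n : ℝ) * s⌋₊ (⌊(n : ℝ) * s'⌋₊ - ⌊(n : ℝ) * s⌋₊)
      (C := M * Real.exp (b * S)) (fun i hi => by
        rw [Nat.add_sub_cancel' hle] at hi
        exact hb.norm_pow_floor_le hn hS hs hi) f
    rw [Nat.add_sub_cancel' hle] at h1
    exact h1

variable [CompleteSpace B]

theorem norm_integral_sub_smul_le {u : ℝ → B} (hu : Continuous u) {L x y : ℝ} (hxy : x ≤ y)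
    (hL : ∀ s, x ≤ s → s ≤ y → ‖u s - u x‖ ≤ L * (s - x)) (hL0 : 0 ≤ L) :
    ‖(∫ s in x..y, u s) - (y - x) • u x‖ ≤ L * (y - x) ^ 2 := by
  rw [← intervalIntegral.integral_const, ← intervalIntegral.integral_sub
    (hu.intervalIntegrable _ _) (continuous_const.intervalIntegrable _ _)]
  refine (intervalIntegral.norm_integral_le_of_norm_le_const (C := L * (y - x)) ?_).trans ?_
  · intro s hs
    rw [Set.uIoc_of_le hxy] at hs
    refine (hL s hs.1.le hs.2).trans ?_
    have := hs.2
    gcongr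
  · rw [abs_of_nonneg (sub_nonneg.2 hxy)]
    apply le_of_eq
    ring

/-- The primitive of a weak orbit solves the equation in integrated form. -/
theorem IsWeakOrbit.integral_mem_closure (hR : IsReflexiveSpace 𝕜 B) {G : ℕ → B →L[𝕜] B}
    {Γ : Submodule 𝕜 (B × B)} (hG : Consistent G (Γ : Set (B × B)))
    (hsep : ∀ y, (∀ φ ψ, DualConsistent G φ ψ → φ y = 0) → y = 0)
    {U : Ultrafilter ℕ} (hU : (U : Filter ℕ) ≤ atTop) {f : B} {u : ℝ → B}
    (h : IsWeakOrbit G (Γ : Set (B × B)) U f u) {η : ℝ} (hη : 0 ≤ η) :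
    (∫ s in (0 : ℝ)..η, u s, u η - f) ∈ closure (Γ : Set (B × B)) := by
  have hpos : ∀ᶠ n : ℕ in U, 0 < n := hU (eventually_gt_atTop 0)
  have hcont := h.continuous
  obtain ⟨L, hL, hlip⟩ := h.lipschitz η hη
  obtain ⟨K, hK, hgr⟩ := h.mem_graph η hη
  have hgr' : ∀ s, ∃ w, 0 ≤ s → s ≤ η → (u s, w) ∈ closure (Γ : Set (B × B)) ∧ ‖w‖ ≤ K := by
    intro s
    by_cases hs : 0 ≤ s ∧ s ≤ η
    · obtain ⟨w, hw⟩ := hgr s hs.1 hs.2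
      exact ⟨w, fun _ _ => hw⟩
    · exact ⟨0, fun h1 h2 => absurd ⟨h1, h2⟩ hs⟩
  choose w hw using hgr'
  have hnode : ∀ N : ℕ, ∀ i ∈ Finset.range N, 0 ≤ (i : ℝ) * (η / N) ∧ (i : ℝ) * (η / N) ≤ η := by
    intro N i hi
    have hiN : (i : ℝ) ≤ N := by exact_mod_cast (Finset.mem_range.1 hi).le
    have hN : (0 : ℝ) < N := by
      have := Finset.mem_range.1 hi
      exact_mod_cast (Nat.zero_le i).trans_lt this
    refine ⟨by positivity, ?_⟩
    calc (i : ℝ) * (η / N) ≤ N * (η / N) := by gcongr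
      _ = η := by field_simp
  -- The second component w is chosen pointwise, with no measurability. Riemann sums replace its
  -- integral: they stay in the closed subspace and are bounded, so they have a weak limit.
  let vN : ℕ → B := fun N => (η / N) • ∑ i ∈ Finset.range N, u (i * (η / N))
  let wN : ℕ → B := fun N => (η / N) • ∑ i ∈ Finset.range N, w (i * (η / N))
  have hmem : ∀ N, (vN N, wN N) ∈ closure (Γ : Set (B × B)) := by
    intro N
    have hS : ∑ i ∈ Finset.range N, (u (i * (η / N)), w (i * (η / N)))
        ∈ Γ.topologicalClosure.restrictScalars ℝ :=
      Submodule.sum_mem _ fun i hi => (hw _ (hnode N i hi).1 (hnode N i hi).2).1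
    have := Submodule.smul_mem _ (η / N) hS
    have e : (vN N, wN N)
        = (η / N) • ∑ i ∈ Finset.range N, (u (i * (η / N)), w (i * (η / N))) := by
      simp [vN, wN, Prod.ext_iff, Prod.fst_sum, Prod.snd_sum]
    rw [e]
    exact this
  have hwN : ∀ᶠ N in U, ‖wN N‖ ≤ η * K := by
    filter_upwards [hpos] with N hN
    have hN' : (0 : ℝ) < N := by exact_mod_cast hN
    have h1 : ‖∑ i ∈ Finset.range N, w (i * (η / N))‖ ≤ ∑ i ∈ Finset.range N, K :=
      norm_sum_le_of_le _ fun i hi => (hw _ (hnode N i hi).1 (hnode N i hi).2).2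
    rw [Finset.sum_const, Finset.card_range, nsmul_eq_mul] at h1
    rw [norm_smul, Real.norm_of_nonneg (by positivity)]
    calc (η / N) * _ ≤ (η / N) * (N * K) := by gcongr
      _ = η * K := by field_simp
  obtain ⟨w', hw'⟩ := hR.exists_weak_limit U wN hwN
  have hvlim : Tendsto vN atTop (𝓝 (∫ s in (0 : ℝ)..η, u s)) := by
    have := tendsto_riemann_sum (I := fun t => ∫ s in (0 : ℝ)..t, u s) (g := u) (L := L) hη
      (fun x y hx hxy hy => by
        rw [intervalIntegral.integral_interval_sub_left (hcont.intervalIntegrable _ _)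
          (hcont.intervalIntegrable _ _)]
        exact norm_integral_sub_smul_le hcont hxy
          (fun s h1 h2 => hlip x s h1 (h2.trans hy)) hL)
    simpa using this
  have hin : (∫ s in (0 : ℝ)..η, u s, w') ∈ closure (Γ : Set (B × B)) :=
    Γ.mk_mem_closure_of_weak_limit (l := (U : Filter ℕ)) (p := fun N => (vN N, wN N))
      (Eventually.of_forall hmem)
      (fun φ => (φ.continuous.tendsto _).comp (hvlim.mono_left hU)) hw'
  -- Dual pairs decide: φ w' = ψ (∫ u) is the limit of Riemann sums of ψ ∘ u, the derivative of φ ∘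
  -- u, hence φ (u η) - φ (u 0).
  have hEq : w' = u η - f := by
    rw [← sub_eq_zero]
    refine hsep _ fun φ ψ hφ => ?_
    obtain ⟨Lφ, hLφ⟩ := h.weak_deriv η hη φ ψ hφ
    have h1 := tendsto_riemann_sum (I := fun t => φ (u t)) (g := fun t => ψ (u t)) hη
      (fun x y hx hxy hy => hLφ x y hx hxy hy)
    have h2 : Tendsto (fun N => ψ (vN N)) atTop (𝓝 (ψ (∫ s in (0 : ℝ)..η, u s))) :=
      (ψ.continuous.tendsto _).comp hvlim
    have h3 := tendsto_nhds_unique (h2.congr fun N => by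
      simp only [vN, ContinuousLinearMap.map_smul_of_tower, map_sum]) h1
    rw [map_sub, hφ.apply_eq hG hin, h3, h.zero, map_sub, sub_self]
  rwa [hEq] at hin

end WeakOrbit

/-! ### The strong limit of the scheme and its generator. -/

section Limit

variable {𝕜 B : Type*} [RCLike 𝕜] [NormedAddCommGroup B] [NormedSpace 𝕜 B]

theorem isClosed_setOf_exists_tendsto [CompleteSpace B] {P : ℕ → B →L[𝕜] B} {C : ℝ}
    (hC : ∀ᶠ n in atTop, ‖P n‖ ≤ C) :
    IsClosed {x | ∃ y, Tendsto (fun n => P n x) atTop (𝓝 y)} := by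
  refine isClosed_of_closure_subset fun x hx => ?_
  refine cauchySeq_tendsto_of_complete (Metric.cauchySeq_iff.2 fun ε hε => ?_)
  have hC' : 0 < |C| + 1 := by positivity
  obtain ⟨x', ⟨y, hy⟩, hxx⟩ := Metric.mem_closure_iff.1 hx (ε / 3 / (|C| + 1)) (by positivity)
  obtain ⟨N, hN⟩ := Metric.cauchySeq_iff.1 hy.cauchySeq (ε / 3) (by positivity)
  obtain ⟨N', hN'⟩ := eventually_atTop.1 hC
  have hd : ∀ n ≥ N', dist (P n x) (P n x') < ε / 3 := by
    intro n hn
    rw [dist_eq_norm, ← map_sub]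
    rw [dist_eq_norm, lt_div_iff₀ hC'] at hxx
    refine ((P n).le_opNorm _).trans_lt ?_
    have h1 := (hN' n hn).trans (le_abs_self C)
    nlinarith [norm_nonneg (x - x')]
  refine ⟨max N N', fun m hm n hn => ?_⟩
  have h1 := hd m ((le_max_right _ _).trans hm)
  have h2 := hd n ((le_max_right _ _).trans hn)
  have h3 := hN m ((le_max_left _ _).trans hm) n ((le_max_left _ _).trans hn)
  have h4 := dist_triangle4 (P m x) (P m x') (P n x') (P n x)
  rw [dist_comm (P n x') (P n x)] at h4
  linarith

/-- `T s` is the strong limit of `G n ^ ⌊n s⌋`. -/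
def IsStrongLimit (G : ℕ → B →L[𝕜] B) (T : ℝ≥0 → B →L[𝕜] B) : Prop :=
  ∀ (s : ℝ≥0) x, Tendsto (fun n : ℕ => (G n ^ ⌊(n : ℝ) * s⌋₊) x) atTop (𝓝 (T s x))

theorem PowerBounded.exists_isStrongLimit {G : ℕ → B →L[𝕜] B} {M b : ℝ} (hb : PowerBounded G M b)
    (h : ∀ (s : ℝ≥0) x, ∃ y, Tendsto (fun n : ℕ => (G n ^ ⌊(n : ℝ) * s⌋₊) x) atTop (𝓝 y)) :
    ∃ T, IsStrongLimit G T := by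
  choose T hT using h
  have hadd : ∀ s x y, T s (x + y) = T s x + T s y := fun s x y =>
    tendsto_nhds_unique (hT s (x + y)) (by simpa using (hT s x).add (hT s y))
  have hsmul : ∀ s (c : 𝕜) x, T s (c • x) = c • T s x := fun s c x =>
    tendsto_nhds_unique (hT s (c • x)) (by simpa using (hT s x).const_smul c)
  refine ⟨fun s => LinearMap.mkContinuous ⟨⟨T s, hadd s⟩, hsmul s⟩ (M * Real.exp (b * s))
    fun x => ?_, hT⟩
  refine le_of_tendsto (hT s x).norm ?_
  filter_upwards [eventually_gt_atTop 0] with n hn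
  exact (ContinuousLinearMap.le_opNorm _ _).trans (by
    have := hb.norm_pow_floor_le hn s.2 le_rfl le_rfl
    gcongr
    exact this)

theorem IsStrongLimit.norm_le {G : ℕ → B →L[𝕜] B} {T : ℝ≥0 → B →L[𝕜] B} (hT : IsStrongLimit G T)
    {M b : ℝ} (hb : PowerBounded G M b) {s : ℝ≥0} {S : ℝ} (hs : s ≤ S) :
    ‖T s‖ ≤ M * Real.exp (b * S) := by
  have hS : 0 ≤ S := s.2.trans hs
  refine ContinuousLinearMap.opNorm_le_bound _
    (zero_le_one.trans (hb.one_le_const hS)) fun x => ?_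
  refine le_of_tendsto (hT s x).norm ?_
  filter_upwards [eventually_gt_atTop 0] with n hn
  exact (ContinuousLinearMap.le_opNorm _ _).trans (by
    have := hb.norm_pow_floor_le hn hS hs le_rfl
    gcongr)

theorem IsStrongLimit.map_zero {G : ℕ → B →L[𝕜] B} {T : ℝ≥0 → B →L[𝕜] B}
    (hT : IsStrongLimit G T) : T 0 = 1 := by
  ext x
  refine tendsto_nhds_unique (hT 0 x) ?_
  simp

theorem floor_add_cases {x y : ℝ} (hx : 0 ≤ x) (hy : 0 ≤ y) :
    ⌊x + y⌋₊ = ⌊x⌋₊ + ⌊y⌋₊ ∨ ⌊x + y⌋₊ = ⌊x⌋₊ + ⌊y⌋₊ + 1 := by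
  have h1 : ⌊x⌋₊ + ⌊y⌋₊ ≤ ⌊x + y⌋₊ := Nat.le_floor (by
    push_cast
    exact add_le_add (Nat.floor_le hx) (Nat.floor_le hy))
  have h2 : ⌊x + y⌋₊ < ⌊x⌋₊ + ⌊y⌋₊ + 2 := by
    rw [Nat.floor_lt (by positivity)]
    push_cast
    have := Nat.lt_floor_add_one x
    have := Nat.lt_floor_add_one y
    linarith
  omega

variable [NormedSpace ℝ B]

theorem Consistent.tendsto_step {G : ℕ → B →L[𝕜] B} {Γ : Set (B × B)} (hG : Consistent G Γ)
    {M b : ℝ} (hb : PowerBounded G M b) (hd : Dense (Prod.fst '' Γ)) (x : B) :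
    Tendsto (fun n => G n x - x) atTop (𝓝 0) := by
  have hC : 1 ≤ M * Real.exp (b * 1) := hb.one_le_const zero_le_one
  set C := M * Real.exp (b * 1)
  rw [Metric.tendsto_atTop']
  intro ε hε
  obtain ⟨_, hxp, ⟨p, hp, rfl⟩⟩ := Metric.dense_iff.1 hd x (ε / (2 * (C + 1))) (by positivity)
  have h0 : Tendsto (fun n : ℕ => (n : ℝ)⁻¹ • ((n : ℝ) • (G n p.1 - p.1))) atTop
      (𝓝 ((0 : ℝ) • p.2)) := tendsto_inv_atTop_nhds_zero_nat.smul (hG p hp)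
  rw [zero_smul] at h0
  obtain ⟨N, hN⟩ := Metric.tendsto_atTop'.1 h0 (ε / 2) (by positivity)
  refine ⟨N, fun n hn => ?_⟩
  have hn0 : 0 < n := (Nat.zero_le N).trans_lt hn
  have h1 := hN n hn
  rw [dist_zero_right, inv_smul_smul₀ (by exact_mod_cast hn0.ne')] at h1
  rw [Metric.mem_ball, dist_comm, dist_eq_norm, lt_div_iff₀ (by positivity)] at hxp
  have hGn : ‖G n‖ ≤ C := by
    have := hb.norm_pow_le (m := 1) (s := 1) hn0 (by
      rw [mul_one]
      exact_mod_cast hn0)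
    rwa [pow_one] at this
  rw [dist_zero_right]
  have e : G n x - x = (G n p.1 - p.1) + G n (x - p.1) - (x - p.1) := by
    rw [map_sub]; abel
  rw [e]
  have h2 := norm_sub_le ((G n p.1 - p.1) + G n (x - p.1)) (x - p.1)
  have h3 := norm_add_le (G n p.1 - p.1) (G n (x - p.1))
  have h4 := (G n).le_opNorm (x - p.1)
  nlinarith [norm_nonneg (x - p.1)]

/-- The floors of n l and n m add up to the floor of n (l + m) or fall one short of it, and a single
step tends strongly to the identity. -/
theorem IsStrongLimit.map_add {G : ℕ → B →L[𝕜] B} {T : ℝ≥0 → B →L[𝕜] B} (hT : IsStrongLimit G T)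
    {Γ : Set (B × B)} (hG : Consistent G Γ)
    {M b : ℝ} (hb : PowerBounded G M b) (hd : Dense (Prod.fst '' Γ)) (l m : ℝ≥0) :
    T (l + m) = T l * T m := by
  ext x
  rw [mul_apply_eq_comp]
  have hlm : (0 : ℝ) ≤ l + m := by positivity
  have hC := hb.one_le_const hlm
  set C := M * Real.exp (b * (l + m : ℝ))
  have hbd : ∀ᶠ n : ℕ in atTop, ∀ k ≤ ⌊(n : ℝ) * (l + m : ℝ)⌋₊, ‖G n ^ k‖ ≤ C := by
    filter_upwards [eventually_gt_atTop 0] with n hn k hk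
    exact hb.norm_pow_floor_le hn hlm le_rfl hk
  have hcase : ∀ n : ℕ, ⌊(n : ℝ) * (l + m : ℝ)⌋₊ = ⌊(n : ℝ) * l⌋₊ + ⌊(n : ℝ) * m⌋₊ ∨
      ⌊(n : ℝ) * (l + m : ℝ)⌋₊ = ⌊(n : ℝ) * l⌋₊ + ⌊(n : ℝ) * m⌋₊ + 1 := by
    intro n
    rw [mul_add]
    exact floor_add_cases (by positivity) (by positivity)
  have h1 : Tendsto (fun n : ℕ => (G n ^ ⌊(n : ℝ) * l⌋₊)
      ((G n ^ ⌊(n : ℝ) * m⌋₊) x - T m x)) atTop (𝓝 0) := by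
    have := ((tendsto_iff_norm_sub_tendsto_zero.1 (hT m x)).const_mul C)
    rw [mul_zero] at this
    refine squeeze_zero_norm' ?_ this
    filter_upwards [hbd] with n hn
    have := hn ⌊(n : ℝ) * l⌋₊ (by rcases hcase n with h | h <;> omega)
    exact (ContinuousLinearMap.le_opNorm _ _).trans (by gcongr)
  have h2 : Tendsto (fun n : ℕ => (G n ^ ⌊(n : ℝ) * (l + m : ℝ)⌋₊) x
      - (G n ^ (⌊(n : ℝ) * l⌋₊ + ⌊(n : ℝ) * m⌋₊)) x) atTop (𝓝 0) := by
    have := (tendsto_norm_zero.comp (hG.tendsto_step hb hd x)).const_mul C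
    rw [mul_zero] at this
    refine squeeze_zero_norm' ?_ this
    filter_upwards [hbd] with n hn
    have hk := hn (⌊(n : ℝ) * l⌋₊ + ⌊(n : ℝ) * m⌋₊) (by rcases hcase n with h | h <;> omega)
    rcases hcase n with h | h
    · rw [h, sub_self, norm_zero]
      have : 0 ≤ C := by linarith
      simp only [Function.comp]
      positivity
    · rw [h, pow_succ, mul_apply_eq_comp, ← map_sub]
      exact (ContinuousLinearMap.le_opNorm _ _).trans (by simp only [Function.comp]; gcongr)
  have h3 := (h2.add h1).add (hT l (T m x))
  rw [add_zero, zero_add] at h3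
  have h4 := hT (l + m) x
  rw [NNReal.coe_add] at h4
  refine tendsto_nhds_unique h4 (h3.congr fun n => ?_)
  rw [_root_.map_sub, ← mul_apply_eq_comp, ← pow_add]
  abel

theorem IsStrongLimit.norm_sub_le {G : ℕ → B →L[𝕜] B} {T : ℝ≥0 → B →L[𝕜] B}
    (hT : IsStrongLimit G T) {Γ : Set (B × B)} (hG : Consistent G Γ)
    {M b : ℝ} (hb : PowerBounded G M b) {p : B × B} (hp : p ∈ Γ) {s s' : ℝ≥0} {S : ℝ}
    (hss : s ≤ s') (hs : s' ≤ S) :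
    ‖T s' p.1 - T s p.1‖ ≤ (s' - s : ℝ) * (M * Real.exp (b * S) * ‖p.2‖) := by
  have hl := ((hT s' p.1).sub (hT s p.1)).norm
  have hr := (tendsto_one_div_atTop_nhds_zero_nat (𝕜 := ℝ)).const_add ((s' : ℝ) - s) |>.mul
    ((hG p hp).norm.const_mul (M * Real.exp (b * S)))
  rw [add_zero] at hr
  refine le_of_tendsto_of_tendsto hl hr ?_
  filter_upwards [eventually_gt_atTop 0] with n hn
  exact hb.norm_orbit_sub_le hn (s'.2.trans hs) (by exact_mod_cast hss) hs p.1

theorem IsStrongLimit.continuous {G : ℕ → B →L[𝕜] B} {T : ℝ≥0 → B →L[𝕜] B}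
    (hT : IsStrongLimit G T) {Γ : Set (B × B)} (hG : Consistent G Γ)
    {M b : ℝ} (hb : PowerBounded G M b) (hd : Dense (Prod.fst '' Γ)) (x : B) :
    Continuous fun s => T s x := by
  have hdom : ∀ p ∈ Γ, Continuous fun s => T s p.1 := by
    intro p hp
    rw [continuous_iff_continuousAt]
    intro s₀
    have hlip : LipschitzOnWith (M * Real.exp (b * (s₀ + 1)) * ‖p.2‖).toNNReal
        (fun s => T s p.1) (Set.Iic (s₀ + 1)) := by
      refine LipschitzOnWith.of_dist_le_mul fun r hr s hs => ?_
      have h0 : (0 : ℝ) ≤ s₀ + 1 := by positivity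
      rw [Real.coe_toNNReal _ (mul_nonneg (zero_le_one.trans (hb.one_le_const h0))
        (norm_nonneg _)), dist_eq_norm, NNReal.dist_eq, mul_comm]
      rcases le_total r s with hrs | hrs
      · rw [norm_sub_rev, abs_sub_comm, abs_of_nonneg (sub_nonneg.2 (by exact_mod_cast hrs))]
        exact hT.norm_sub_le hG hb hp hrs (by exact_mod_cast hs)
      · rw [abs_of_nonneg (sub_nonneg.2 (by exact_mod_cast hrs))]
        exact hT.norm_sub_le hG hb hp hrs (by exact_mod_cast hr)
    exact hlip.continuousOn.continuousAt (Iic_mem_nhds (by simp))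
  rw [continuous_iff_continuousAt]
  intro s₀
  refine continuousAt_of_locally_uniform_approx_of_continuousAt fun V hV => ?_
  obtain ⟨ε, hε, hεV⟩ := Metric.mem_uniformity_dist.1 hV
  have hC := hb.one_le_const (s := s₀ + 1) (by positivity)
  set C := M * Real.exp (b * (s₀ + 1))
  obtain ⟨_, hxp, ⟨p, hp, rfl⟩⟩ := Metric.dense_iff.1 hd x (ε / C) (by positivity)
  refine ⟨Set.Iic (s₀ + 1), Iic_mem_nhds (by simp), fun s => T s p.1,
    (hdom p hp).continuousAt, fun s hs => hεV ?_⟩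
  rw [Metric.mem_ball, dist_comm, dist_eq_norm, lt_div_iff₀ (by positivity)] at hxp
  rw [dist_eq_norm, ← _root_.map_sub]
  refine ((T s).le_opNorm _).trans_lt ?_
  have := hT.norm_le hb (s := s) (S := s₀ + 1) (by exact_mod_cast hs)
  nlinarith [norm_nonneg (x - p.1)]

theorem IsStrongLimit.isC0Semigroup {G : ℕ → B →L[𝕜] B} {T : ℝ≥0 → B →L[𝕜] B}
    (hT : IsStrongLimit G T) {Γ : Set (B × B)} (hG : Consistent G Γ)
    {M b : ℝ} (hb : PowerBounded G M b) (hd : Dense (Prod.fst '' Γ)) : IsC0Semigroup T where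
  map_zero := hT.map_zero
  map_add := hT.map_add hG hb hd
  continuous := hT.continuous hG hb hd
  bound := by
    -- The definition asks for a constant strictly above 1.
    refine ⟨M + 1, b, by linarith [hb.one_le], fun s => ?_⟩
    refine (hT.norm_le hb le_rfl).trans ?_
    gcongr
    linarith

theorem isClosed_setOf_integral_mem {T : ℝ≥0 → B →L[𝕜] B} (hT : IsC0Semigroup T) (Γ : Set (B × B))
    (η : ℝ≥0) : IsClosed
      {x | (∫ s in (0 : ℝ)..η, T s.toNNReal x, T η x - x) ∈ closure Γ} := by
  obtain ⟨M, a, hM, hbd⟩ := hT.bound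
  have hint : ∀ x, IntervalIntegrable (fun s : ℝ => T s.toNNReal x) MeasureTheory.volume 0 η :=
    fun x => ((hT.continuous x).comp continuous_real_toNNReal).intervalIntegrable _ _
  have hc : Continuous fun x => ∫ s in (0 : ℝ)..η, T s.toNNReal x := by
    refine (LipschitzWith.of_dist_le_mul (K := (M * Real.exp (|a| * η) * η).toNNReal)
      fun x y => ?_).continuous
    rw [Real.coe_toNNReal _ (by positivity), dist_eq_norm, dist_eq_norm,
      ← intervalIntegral.integral_sub (hint x) (hint y)]
    refine (intervalIntegral.norm_integral_le_of_norm_le_const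
      (C := M * Real.exp (|a| * η) * ‖x - y‖) fun s hs => ?_).trans (le_of_eq ?_)
    · rw [Set.uIoc_of_le (NNReal.coe_nonneg η)] at hs
      rw [← _root_.map_sub]
      refine (ContinuousLinearMap.le_opNorm _ _).trans ?_
      have h1 := hbd s.toNNReal
      rw [Real.coe_toNNReal _ hs.1.le] at h1
      have h2 : a * s ≤ |a| * η :=
        mul_le_mul (le_abs_self a) hs.2 hs.1.le (abs_nonneg a)
      have h3 : ‖T s.toNNReal‖ ≤ M * Real.exp (|a| * η) := h1.trans (by gcongr)
      gcongr
    · rw [sub_zero, abs_of_nonneg (NNReal.coe_nonneg η)]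
      ring
  exact isClosed_closure.preimage (hc.prodMk ((T η).continuous.sub continuous_id))

variable [IsScalarTower ℝ 𝕜 B]

/-- The i-th increment is n⁻¹ (T ^ i) applied to the quotient of x, which is close to y. To control
(T ^ i) y - y, where y need not be in the domain, y is replaced by z, whose orbit is Lipschitz. -/
theorem norm_pow_sub_sub_smul_le (T : B →L[𝕜] B) {n : ℕ} (hn : 0 < n) (k : ℕ) {C : ℝ}
    (hC1 : 1 ≤ C) (hC : ∀ i ≤ k, ‖T ^ i‖ ≤ C) (x y z : B) :
    ‖(T ^ k) x - x - (k / n : ℝ) • y‖ ≤ (k / n : ℝ) * (C * ‖(n : ℝ) • (T x - x) - y‖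
      + 2 * C * ‖y - z‖ + (k / n : ℝ) * (C * ‖(n : ℝ) • (T z - z)‖)) := by
  have hn' : (0 : ℝ) < n := by exact_mod_cast hn
  have hsum : (T ^ k) x - x - (k / n : ℝ) • y = ∑ i ∈ Finset.range k, (n : ℝ)⁻¹ •
      ((T ^ i) ((n : ℝ) • (T x - x) - y) + (T ^ i) (y - z) - (y - z) + ((T ^ i) z - z)) := by
    have h1 := Finset.sum_range_sub (fun i => (T ^ i) x) k
    simp only [pow_zero, one_apply_eq_self] at h1
    have h2 : (k / n : ℝ) • y = ∑ i ∈ Finset.range k, (n : ℝ)⁻¹ • y := by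
      rw [Finset.sum_const, Finset.card_range, ← Nat.cast_smul_eq_nsmul ℝ, smul_smul,
        div_eq_mul_inv]
    rw [← h1, h2, ← Finset.sum_sub_distrib]
    refine Finset.sum_congr rfl fun i _ => ?_
    have h3 : (n : ℝ)⁻¹ • (T ^ i) ((n : ℝ) • (T x - x)) = (T ^ (i + 1)) x - (T ^ i) x := by
      rw [ContinuousLinearMap.map_smul_of_tower, inv_smul_smul₀ hn'.ne', map_sub, pow_succ,
        mul_apply_eq_comp]
    rw [← h3, ← smul_sub]
    congr 1
    simp only [map_sub]
    abel
  rw [hsum]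
  refine (norm_sum_le_of_le (f := _) _ (n := fun _ => (n : ℝ)⁻¹ * (C * ‖(n : ℝ) • (T x - x) - y‖
      + 2 * C * ‖y - z‖ + (k / n : ℝ) * (C * ‖(n : ℝ) • (T z - z)‖))) fun i hi => ?_).trans ?_
  · have hik : i ≤ k := (Finset.mem_range.1 hi).le
    have hik' : (i : ℝ) ≤ k := by exact_mod_cast hik
    rw [norm_smul, norm_inv, Real.norm_of_nonneg hn'.le]
    refine mul_le_mul_of_nonneg_left ?_ (by positivity)
    have h1 := norm_pow_add_sub_pow_le' T 0 i hn (fun l hl => hC l (by omega)) z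
    simp only [zero_add, pow_zero, one_apply_eq_self] at h1
    have h2 : (i / n : ℝ) * (C * ‖(n : ℝ) • (T z - z)‖)
      ≤ (k / n : ℝ) * (C * ‖(n : ℝ) • (T z - z)‖) := by gcongr
    have h3 : ∀ w, ‖(T ^ i) w‖ ≤ C * ‖w‖ := fun w =>
      (ContinuousLinearMap.le_opNorm _ _).trans (by have := hC i hik; gcongr)
    have h4 := h3 ((n : ℝ) • (T x - x) - y)
    have h5 := h3 (y - z)
    have h6 := norm_add_le ((T ^ i) ((n : ℝ) • (T x - x) - y) + (T ^ i) (y - z) - (y - z))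
      ((T ^ i) z - z)
    have h7 := norm_sub_le ((T ^ i) ((n : ℝ) • (T x - x) - y) + (T ^ i) (y - z)) (y - z)
    have h8 := norm_add_le ((T ^ i) ((n : ℝ) • (T x - x) - y)) ((T ^ i) (y - z))
    nlinarith [norm_nonneg (y - z)]
  · rw [Finset.sum_const, Finset.card_range, nsmul_eq_mul]
    apply le_of_eq
    ring

/-- The discrete estimate passes to the limit for p in Γ, and the resulting inequality is closed in
p. With q.1 near p.2, the right-hand side is o(s). -/
theorem IsStrongLimit.norm_sub_sub_smul_le {G : ℕ → B →L[𝕜] B} {T : ℝ≥0 → B →L[𝕜] B}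
    (hT : IsStrongLimit G T) {Γ : Set (B × B)} (hG : Consistent G Γ)
    {M b : ℝ} (hb : PowerBounded G M b) {p q : B × B} (hp : p ∈ closure Γ) (hq : q ∈ Γ)
    {s : ℝ≥0} (hs : s ≤ 1) :
    ‖T s p.1 - p.1 - (s : ℝ) • p.2‖ ≤ s * (2 * (M * Real.exp (b * 1)) * ‖p.2 - q.1‖
      + s * (M * Real.exp (b * 1) * ‖q.2‖)) := by
  have hC : 1 ≤ M * Real.exp (b * 1) := hb.one_le_const zero_le_one
  set C := M * Real.exp (b * 1)
  have hc : IsClosed {p : B × B | ‖T s p.1 - p.1 - (s : ℝ) • p.2‖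
      ≤ s * (2 * C * ‖p.2 - q.1‖ + s * (C * ‖q.2‖))} :=
    isClosed_le (by fun_prop) (by fun_prop)
  refine closure_minimal (fun r hr => ?_) hc hp
  have hk := tendsto_floor_mul_div (s : ℝ) s.2
  have hl := (((hT s r.1).sub_const r.1).sub (hk.smul_const r.2)).norm
  have hA := (((hG r hr).sub_const r.2).norm.const_mul C)
  rw [sub_self, norm_zero, mul_zero] at hA
  have hrt := hk.mul ((hA.add_const (2 * C * ‖r.2 - q.1‖)).add
    (hk.mul ((hG q hq).norm.const_mul C)))
  rw [zero_add] at hrt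
  refine le_of_tendsto_of_tendsto hl hrt ?_
  filter_upwards [eventually_gt_atTop 0] with n hn
  exact norm_pow_sub_sub_smul_le (G n) hn _ hC
    (fun i hi => hb.norm_pow_floor_le hn zero_le_one (by exact_mod_cast hs) hi) r.1 r.2 q.1

theorem IsStrongLimit.hasStrongDerivZero {G : ℕ → B →L[𝕜] B} {T : ℝ≥0 → B →L[𝕜] B}
    (hT : IsStrongLimit G T) {Γ : Set (B × B)} (hG : Consistent G Γ)
    {M b : ℝ} (hb : PowerBounded G M b) (hd : Dense (Prod.fst '' Γ)) {p : B × B}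
    (hp : p ∈ closure Γ) : HasStrongDerivZero T p.1 p.2 := by
  have hC : 1 ≤ M * Real.exp (b * 1) := hb.one_le_const zero_le_one
  set C := M * Real.exp (b * 1) with hCdef
  unfold HasStrongDerivZero
  rw [Metric.tendsto_nhds]
  intro ε hε
  obtain ⟨_, hxq, ⟨q, hq, rfl⟩⟩ := Metric.dense_iff.1 hd p.2 (ε / (4 * C)) (by positivity)
  rw [Metric.mem_ball, dist_comm, dist_eq_norm, lt_div_iff₀ (by positivity)] at hxq
  have hev : ∀ᶠ s : ℝ≥0 in 𝓝[>] 0, (s : ℝ) * (C * ‖q.2‖) < ε / 2 := by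
    have : Tendsto (fun s : ℝ≥0 => (s : ℝ) * (C * ‖q.2‖)) (𝓝 0) (𝓝 ((0 : ℝ≥0) * (C * ‖q.2‖))) :=
      Continuous.tendsto (by fun_prop) 0
    rw [NNReal.coe_zero, zero_mul] at this
    exact nhdsWithin_le_nhds (this.eventually_lt_const (by positivity))
  filter_upwards [hev, self_mem_nhdsWithin,
    nhdsWithin_le_nhds (Iic_mem_nhds (show (0 : ℝ≥0) < 1 by simp))] with s h1 hs0 hs1
  have hs0' : (0 : ℝ) < s := by exact_mod_cast hs0
  have h2 := hT.norm_sub_sub_smul_le hG hb hp hq hs1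
  rw [← hCdef] at h2
  have e : ((s : ℝ) : 𝕜)⁻¹ • (T s p.1 - T 0 p.1) - p.2
      = (s : ℝ)⁻¹ • (T s p.1 - p.1 - (s : ℝ) • p.2) := by
    rw [hT.map_zero, one_apply_eq_self, smul_sub (s : ℝ)⁻¹, inv_smul_smul₀ hs0'.ne',
      ← RCLike.ofReal_inv, RCLike.real_smul_eq_coe_smul (K := 𝕜)]
  rw [dist_eq_norm, e, norm_smul, norm_inv, Real.norm_of_nonneg hs0'.le, inv_mul_lt_iff₀ hs0']
  refine h2.trans_lt ?_
  gcongr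
  linarith

variable [CompleteSpace B]

theorem tendsto_average {u : ℝ → B} (hu : Continuous u) :
    Tendsto (fun η : ℝ≥0 => (η : ℝ)⁻¹ • ∫ s in (0 : ℝ)..η, u s) (𝓝[>] 0) (𝓝 (u 0)) := by
  have h1 : HasDerivAt (fun η => ∫ s in (0 : ℝ)..η, u s) (u 0) 0 :=
    (hu.integral_hasStrictDerivAt 0 0).hasDerivAt
  rw [hasDerivAt_iff_tendsto_slope_zero] at h1
  simp only [zero_add, intervalIntegral.integral_same, sub_zero] at h1
  refine h1.comp (tendsto_nhdsWithin_iff.2 ⟨?_, ?_⟩)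
  · have : Tendsto ((↑) : ℝ≥0 → ℝ) (𝓝 0) (𝓝 ((0 : ℝ≥0) : ℝ)) := NNReal.continuous_coe.tendsto 0
    exact this.mono_left nhdsWithin_le_nhds
  · filter_upwards [self_mem_nhdsWithin] with η hη
    have : (0 : ℝ≥0) < η := hη
    simpa using this.ne'

/-- The pair (x, y) is the limit, as η tends to 0, of η⁻¹ times the pairs in the hypothesis. -/
theorem mem_closure_of_hasStrongDerivZero {T : ℝ≥0 → B →L[𝕜] B} (hT : IsC0Semigroup T)
    {Γ : Submodule 𝕜 (B × B)}
    (hΓ : ∀ x, ∀ η : ℝ≥0, (∫ s in (0 : ℝ)..η, T s.toNNReal x, T η x - x) ∈ closure (Γ : Set (B × B)))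
    {x y : B} (h : HasStrongDerivZero T x y) : (x, y) ∈ closure (Γ : Set (B × B)) := by
  have h1 := tendsto_average ((hT.continuous x).comp continuous_real_toNNReal)
  simp only [Function.comp, Real.toNNReal_zero, hT.map_zero, one_apply_eq_self] at h1
  refine isClosed_closure.mem_of_tendsto (h1.prodMk_nhds h) (Eventually.of_forall fun η => ?_)
  have h2 := Γ.topologicalClosure.smul_mem (((η : ℝ) : 𝕜)⁻¹) (hΓ x η)
  rw [Prod.smul_mk, ← RCLike.ofReal_inv, ← RCLike.real_smul_eq_coe_smul (K := 𝕜) _ (∫ s in _.._, _)]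
    at h2
  rw [hT.map_zero, one_apply_eq_self, ← RCLike.ofReal_inv]
  exact h2

end Limit

/-! ### From weak orbits to the semigroup, and Chernoff's formula. -/

section Generation

variable {𝕜 B : Type*} [RCLike 𝕜] [NormedAddCommGroup B] [NormedSpace 𝕜 B] [NormedSpace ℝ B]
  [IsScalarTower ℝ 𝕜 B] [CompleteSpace B]

/-- Integrating over a moving window gains the missing regularity: the window integral has
derivative u (s + η) - u s, Lipschitz in norm, and the pair stays in the closure of Γ, so the Lax
principle applies. -/
theorem IsWeakOrbit.tendsto_integral (hR : IsReflexiveSpace 𝕜 B) {G : ℕ → B →L[𝕜] B}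
    {Γ : Submodule 𝕜 (B × B)} (hG : Consistent G (Γ : Set (B × B))) {M b : ℝ}
    (hb : PowerBounded G M b)
    (hsep : ∀ y, (∀ φ ψ, DualConsistent G φ ψ → φ y = 0) → y = 0)
    {U : Ultrafilter ℕ} (hU : (U : Filter ℕ) ≤ atTop) {f : B} {u : ℝ → B}
    (h : IsWeakOrbit G (Γ : Set (B × B)) U f u) {η S : ℝ} (hη : 0 ≤ η) (hS : 0 ≤ S) :
    Tendsto (fun n : ℕ => (G n ^ ⌊(n : ℝ) * S⌋₊) (∫ s in (0 : ℝ)..η, u s)) atTop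
      (𝓝 (∫ s in S..(S + η), u s)) := by
  have hcont := h.continuous
  have hint : ∀ x y : ℝ, IntervalIntegrable u MeasureTheory.volume x y :=
    fun x y => hcont.intervalIntegrable x y
  obtain ⟨L, hL, hlip⟩ := h.lipschitz (S + η) (by positivity)
  have hmem : ∀ s, 0 ≤ s →
      (∫ r in s..(s + η), u r, u (s + η) - u s) ∈ closure (Γ : Set (B × B)) := by
    intro s hs
    have h1 := h.integral_mem_closure hR hG hsep hU (add_nonneg hs hη)
    have h2 := h.integral_mem_closure hR hG hsep hU hs
    have h3 := Γ.topologicalClosure.sub_mem h1 h2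
    rw [Prod.mk_sub_mk, intervalIntegral.integral_interval_sub_left (hint _ _) (hint _ _),
      sub_sub_sub_cancel_right] at h3
    exact h3
  have key := hG.tendsto_pow_floor hb hS (fun s => ∫ r in s..(s + η), u r)
    (fun s => u (s + η) - u s) hmem ?_
  · simpa using key
  intro ε hε
  -- Both errors are differences of two Lipschitz terms, giving 2 L k² and 2 L k; the 1 keeps the
  -- denominator positive.
  refine ⟨ε / (2 * L + 1), by positivity, fun s k hs hk hkδ hsk => ?_⟩
  rw [le_div_iff₀ (by positivity)] at hkδ
  have e1 : ∀ x : ℝ, x + k ≤ S + η → ‖(∫ r in x..(x + k), u r) - k • u x‖ ≤ L * k ^ 2 := by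
    intro x hx
    have := norm_integral_sub_smul_le hcont (x := x) (y := x + k) (L := L) (by linarith)
      (fun r h1 h2 => hlip x r h1 (h2.trans hx)) hL
    rwa [add_sub_cancel_left] at this
  have e2 : ∀ x : ℝ, x + k ≤ S + η → ‖u (x + k) - u x‖ ≤ L * k := by
    intro x hx
    have := hlip x (x + k) (by linarith) hx
    rwa [add_sub_cancel_left] at this
  have a1 := e1 s (by linarith)
  have a2 := e1 (s + η) (by linarith)
  have b1 := e2 s (by linarith)
  have b2 := e2 (s + η) (by linarith)
  have hcomm : s + k + η = s + η + k := by ring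
  constructor
  · have hsplit : (∫ r in (s + k)..(s + k + η), u r) - (∫ r in s..(s + η), u r)
        = (∫ r in (s + η)..(s + η + k), u r) - ∫ r in s..(s + k), u r := by
      have c1 := intervalIntegral.integral_add_adjacent_intervals (hint s (s + k))
        (hint (s + k) (s + k + η))
      have c2 := intervalIntegral.integral_add_adjacent_intervals (hint s (s + η))
        (hint (s + η) (s + k + η))
      rw [hcomm] at c1 c2 ⊢
      rw [sub_eq_sub_iff_add_eq_add, add_comm, c1, add_comm (∫ r in (s + η).._, u r), c2]
    rw [hsplit]
    have e : (∫ r in (s + η)..(s + η + k), u r) - (∫ r in s..(s + k), u r)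
        - k • (u (s + η) - u s) = ((∫ r in (s + η)..(s + η + k), u r) - k • u (s + η))
          - ((∫ r in s..(s + k), u r) - k • u s) := by
      rw [smul_sub]; abel
    rw [e]
    refine (norm_sub_le _ _).trans ?_
    nlinarith
  · have e : u (s + k + η) - u (s + k) - (u (s + η) - u s)
        = (u (s + η + k) - u (s + η)) - (u (s + k) - u s) := by
      rw [hcomm]; abel
    rw [e]
    refine (norm_sub_le _ _).trans ?_
    nlinarith

theorem IsWeakOrbit.exists_tendsto (hR : IsReflexiveSpace 𝕜 B) {G : ℕ → B →L[𝕜] B}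
    {Γ : Submodule 𝕜 (B × B)} (hG : Consistent G (Γ : Set (B × B))) {M b : ℝ}
    (hb : PowerBounded G M b)
    (hsep : ∀ y, (∀ φ ψ, DualConsistent G φ ψ → φ y = 0) → y = 0)
    {U : Ultrafilter ℕ} (hU : (U : Filter ℕ) ≤ atTop) {f : B} {u : ℝ → B}
    (h : IsWeakOrbit G (Γ : Set (B × B)) U f u) (S : ℝ≥0) :
    ∃ y, Tendsto (fun n : ℕ => (G n ^ ⌊(n : ℝ) * S⌋₊) f) atTop (𝓝 y) := by
  have hcl : IsClosed {x | ∃ y, Tendsto (fun n : ℕ => (G n ^ ⌊(n : ℝ) * S⌋₊) x) atTop (𝓝 y)} :=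
    isClosed_setOf_exists_tendsto (C := M * Real.exp (b * S)) (by
      filter_upwards [eventually_gt_atTop 0] with n hn
      exact hb.norm_pow_floor_le hn S.2 le_rfl le_rfl)
  have h1 := tendsto_average h.continuous
  rw [h.zero] at h1
  refine hcl.mem_of_tendsto h1 (Eventually.of_forall fun η => ?_)
  have h2 := (h.tendsto_integral hR hG hb hsep hU η.2 S.2).const_smul (η : ℝ)⁻¹
  refine ⟨_, h2.congr fun n => ?_⟩
  rw [ContinuousLinearMap.map_smul_of_tower]
  rfl

/-- Generation theorem: a stable and consistent scheme whose orbits, for a dense set of initial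
values, stay close to graph-bounded sequences converges to a semigroup whose generator has graph
`closure Γ`. -/
theorem exists_isC0Semigroup_of_approx (hR : IsReflexiveSpace 𝕜 B) {G : ℕ → B →L[𝕜] B}
    {Γ : Submodule 𝕜 (B × B)} (hG : Consistent G (Γ : Set (B × B))) {M b : ℝ}
    (hb : PowerBounded G M b)
    (hsep : ∀ y, (∀ φ ψ, DualConsistent G φ ψ → φ y = 0) → y = 0)
    {A : Set B} (hA : Dense A) (hAΓ : ∀ f ∈ A, ∃ z, (f, z) ∈ Γ)
    (happ : ∀ f ∈ A, ∀ s : ℝ, 0 ≤ s → ∃ q : ℕ → B × B, (∀ n, q n ∈ Γ) ∧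
      Tendsto (fun n : ℕ => (G n ^ ⌊(n : ℝ) * s⌋₊) f - (q n).1) atTop (𝓝 0) ∧
      ∃ R, ∀ n, ‖(q n).2‖ ≤ R) :
    ∃ T : ℝ≥0 → B →L[𝕜] B, IsC0Semigroup T ∧
      ∀ x y, (x, y) ∈ closure (Γ : Set (B × B)) ↔ HasStrongDerivZero T x y := by
  obtain ⟨U, hU⟩ := Ultrafilter.exists_le (atTop : Filter ℕ)
  have horb : ∀ f ∈ A, ∃ u, IsWeakOrbit G (Γ : Set (B × B)) U f u := by
    intro f hf
    obtain ⟨z, hz⟩ := hAΓ f hf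
    exact exists_isWeakOrbit hR hb hG hsep hU hz (happ f hf)
  obtain ⟨T, hT⟩ := hb.exists_isStrongLimit fun s x => by
    have hcl : IsClosed {x | ∃ y, Tendsto (fun n : ℕ => (G n ^ ⌊(n : ℝ) * s⌋₊) x) atTop (𝓝 y)} :=
      isClosed_setOf_exists_tendsto (C := M * Real.exp (b * s)) (by
        filter_upwards [eventually_gt_atTop 0] with n hn
        exact hb.norm_pow_floor_le hn s.2 le_rfl le_rfl)
    refine closure_minimal (fun f hf => ?_) hcl (hA x)
    obtain ⟨u, hu⟩ := horb f hf
    exact hu.exists_tendsto hR hG hb hsep hU s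
  have hd : Dense (Prod.fst '' (Γ : Set (B × B))) := hA.mono fun f hf => by
    obtain ⟨z, hz⟩ := hAΓ f hf
    exact ⟨(f, z), hz, rfl⟩
  have hsg := hT.isC0Semigroup hG hb hd
  refine ⟨T, hsg, fun x y => ⟨fun h => hT.hasStrongDerivZero hG hb hd h,
    mem_closure_of_hasStrongDerivZero hsg fun x η => ?_⟩⟩
  refine closure_minimal (fun f hf => ?_) (isClosed_setOf_integral_mem hsg _ η) (hA x)
  obtain ⟨u, hu⟩ := horb f hf
  -- Strong and weak limits along the ultrafilter coincide, so the integrated equation for u is one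
  -- for T.
  have huT : ∀ s : ℝ≥0, u s = T s f := by
    intro s
    rw [← sub_eq_zero]
    refine SeparatingDual.eq_zero_of_forall_dual_eq_zero (R := 𝕜) fun φ => ?_
    rw [map_sub, sub_eq_zero]
    exact tendsto_nhds_unique (hu.weak_limit s φ)
      ((φ.continuous.tendsto _).comp ((hT s f).mono_left hU))
  have h1 := hu.integral_mem_closure hR hG hsep hU η.2
  have h2 : ∫ s in (0 : ℝ)..η, T s.toNNReal f = ∫ s in (0 : ℝ)..η, u s := by
    refine intervalIntegral.integral_congr fun s hs => ?_
    rw [Set.uIcc_of_le (NNReal.coe_nonneg η)] at hs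
    have := huT s.toNNReal
    rw [Real.coe_toNNReal _ hs.1] at this
    exact this.symm
  rw [Set.mem_ofPred_eq, h2, ← huT]
  exact h1

omit [CompleteSpace B] in
/-- Chernoff's product formula on the domain of the generator. -/
theorem IsC0Semigroup.tendsto_pow_floor {T : ℝ≥0 → B →L[𝕜] B} (hT : IsC0Semigroup T)
    {G : ℕ → B →L[𝕜] B} {Γ : Set (B × B)} (hG : Consistent G Γ) {M b : ℝ}
    (hb : PowerBounded G M b) {f z : B} (hf : HasStrongDerivZero T f z)
    (hΓ : ∀ s, (T s f, T s z) ∈ closure Γ) (S : ℝ≥0) :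
    Tendsto (fun n : ℕ => (G n ^ ⌊(n : ℝ) * S⌋₊) f) atTop (𝓝 (T S f)) := by
  obtain ⟨M', a, hM', hbd⟩ := hT.bound
  have key := hG.tendsto_pow_floor hb (NNReal.coe_nonneg S) (fun s => T s.toNNReal f) (fun s => T s.toNNReal z)
    (fun s _ => hΓ _) ?_
  · simpa [hT.map_zero] using key
  intro ε hε
  set C := M' * Real.exp (|a| * S) with hCdef
  have hC : 0 < C := by positivity
  have hTC : ∀ s : ℝ, 0 ≤ s → s ≤ S → ‖T s.toNNReal‖ ≤ C := by
    intro s hs0 hs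
    refine (hbd _).trans ?_
    rw [Real.coe_toNNReal _ hs0]
    have h2 : a * s ≤ |a| * S := mul_le_mul (le_abs_self a) hs hs0 (abs_nonneg a)
    rw [hCdef]
    gcongr
  have hz : ∀ᶠ h : ℝ≥0 in 𝓝[>] 0, ‖T h z - z‖ < ε / C := by
    have h1 := ((hT.continuous z).tendsto 0).sub_const z
    simp only [hT.map_zero, one_apply_eq_self, sub_self] at h1
    exact nhdsWithin_le_nhds ((tendsto_zero_iff_norm_tendsto_zero.1 h1).eventually_lt_const
      (by positivity))
  have hd : ∀ᶠ h : ℝ≥0 in 𝓝[>] 0,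
      ‖((h : ℝ) : 𝕜)⁻¹ • (T h f - T 0 f) - z‖ < ε / C :=
    (tendsto_iff_norm_sub_tendsto_zero.1 hf).eventually_lt_const (by positivity)
  -- The step δ is found at time 0 with tolerance ε / C; the semigroup law carries it to every s up
  -- to S at the cost of the factor C.
  obtain ⟨δ, hδ, hδs⟩ := mem_nhdsGT_iff_exists_Ioc_subset.1 (hz.and hd)
  refine ⟨δ, hδ, fun s h hs hh hhδ hsh => ?_⟩
  rcases hh.eq_or_lt with rfl | hh
  · simp [hε.le]
  lift h to ℝ≥0 using hh.le
  lift s to ℝ≥0 using hs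
  obtain ⟨h1, h2⟩ := hδs ⟨by exact_mod_cast hh, by exact_mod_cast hhδ⟩
  have hTs := hTC s (NNReal.coe_nonneg s) (by linarith)
  rw [lt_div_iff₀ hC] at h1 h2
  rw [← NNReal.coe_add]
  simp only [Real.toNNReal_coe] at hTs ⊢
  rw [hT.map_add, mul_apply_eq_comp, mul_apply_eq_comp]
  rw [hT.map_zero, one_apply_eq_self, ← RCLike.ofReal_inv,
    ← RCLike.real_smul_eq_coe_smul (K := 𝕜)] at h2
  constructor
  · have e : T s (T h f) - T s f - (h : ℝ) • T s z
        = (h : ℝ) • T s ((h : ℝ)⁻¹ • (T h f - f) - z) := by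
      rw [map_sub, ContinuousLinearMap.map_smul_of_tower, smul_sub (h : ℝ),
        smul_inv_smul₀ hh.ne', map_sub]
    rw [e, norm_smul, Real.norm_of_nonneg hh.le, mul_comm]
    have h3 := (T s).le_opNorm ((h : ℝ)⁻¹ • (T h f - f) - z)
    have h4 : ‖T s ((h : ℝ)⁻¹ • (T h f - f) - z)‖ ≤ ε := by
      nlinarith [norm_nonneg ((h : ℝ)⁻¹ • (T h f - f) - z)]
    gcongr
  · rw [← map_sub]
    have h3 := (T s).le_opNorm (T h z - z)
    nlinarith [norm_nonneg (T h z - z)]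

end Generation

/-! ### Rescaling of time and generator graphs. -/

section Rescaling

variable {𝕜 E : Type*} [RCLike 𝕜] [NormedAddCommGroup E] [NormedSpace 𝕜 E]

theorem HasStrongDerivZero.comp_mul {S : ℝ≥0 → E →L[𝕜] E} {x y : E}
    (h : HasStrongDerivZero S x y) {c : ℝ≥0} (hc : 0 < c) :
    HasStrongDerivZero (fun s => S (c * s)) x (((c : ℝ) : 𝕜) • y) := by
  have hlim : Tendsto (fun s : ℝ≥0 => c * s) (𝓝[>] 0) (𝓝[>] 0) := by
    refine tendsto_nhdsWithin_iff.2 ⟨?_, ?_⟩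
    · have : Tendsto (fun s : ℝ≥0 => c * s) (𝓝 0) (𝓝 (c * 0)) :=
        Continuous.tendsto (by fun_prop) 0
      rw [mul_zero] at this
      exact this.mono_left nhdsWithin_le_nhds
    · filter_upwards [self_mem_nhdsWithin] with s hs
      exact mul_pos hc hs
  refine ((h.comp hlim).const_smul ((c : ℝ) : 𝕜)).congr fun s => ?_
  have hc' : ((c : ℝ) : 𝕜) ≠ 0 := by exact_mod_cast hc.ne'
  simp only [Function.comp, mul_zero, smul_smul]
  congr 1
  push_cast
  rw [mul_inv, ← mul_assoc, mul_inv_cancel₀ hc', one_mul]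

theorem IsC0Semigroup.comp_mul {T : ℝ≥0 → E →L[𝕜] E} (hT : IsC0Semigroup T) (c : ℝ≥0) :
    IsC0Semigroup fun s => T (c * s) where
  map_zero := by rw [mul_zero, hT.map_zero]
  map_add l m := by rw [mul_add, hT.map_add]
  continuous x := (hT.continuous x).comp (by fun_prop)
  bound := by
    obtain ⟨M, a, hM, h⟩ := hT.bound
    refine ⟨M, a * c, hM, fun s => ?_⟩
    have := h (c * s)
    rwa [NNReal.coe_mul, ← mul_assoc] at this

theorem HasStrongDerivZero.tendsto_nat {S : ℝ≥0 → E →L[𝕜] E} {x y : E}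
    (h : HasStrongDerivZero S x y) {t : ℝ≥0} (ht : 0 < t) :
    Tendsto (fun n : ℕ => (n : 𝕜) • (S (t / n) x - S 0 x)) atTop (𝓝 (((t : ℝ) : 𝕜) • y)) := by
  have hlim : Tendsto (fun n : ℕ => t / (n : ℝ≥0)) atTop (𝓝[>] 0) := by
    refine tendsto_nhdsWithin_iff.2 ⟨?_, ?_⟩
    · rw [← NNReal.tendsto_coe]
      push_cast
      exact tendsto_const_div_atTop_nhds_zero_nat _
    · filter_upwards [eventually_gt_atTop 0] with n hn
      have : (0 : ℝ≥0) < n := by exact_mod_cast hn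
      exact div_pos ht this
  refine ((h.comp hlim).const_smul ((t : ℝ) : 𝕜)).congr' ?_
  filter_upwards [eventually_gt_atTop 0] with n hn
  have ht' : ((t : ℝ) : 𝕜) ≠ 0 := by exact_mod_cast ht.ne'
  simp only [Function.comp, smul_smul]
  congr 1
  push_cast
  rw [inv_div, mul_div_cancel₀ _ ht']

theorem IsC0Semigroup.hasStrongDerivZero_apply {T : ℝ≥0 → E →L[𝕜] E} (hT : IsC0Semigroup T)
    {x y : E} (h : HasStrongDerivZero T x y) (s : ℝ≥0) :
    HasStrongDerivZero T (T s x) (T s y) := by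
  refine (((T s).continuous.tendsto y).comp h).congr fun r => ?_
  simp only [Function.comp, map_smul, map_sub]
  rw [← mul_apply_eq_comp, ← mul_apply_eq_comp, ← mul_apply_eq_comp, ← mul_apply_eq_comp,
    ← hT.map_add, ← hT.map_add, ← hT.map_add, ← hT.map_add, add_comm s r, add_comm s 0]

theorem mem_graph_strongDerivZero {S : ℝ≥0 → E →L[𝕜] E} {x y : E} :
    (x, y) ∈ (strongDerivZero S).graph ↔ HasStrongDerivZero S x y := by
  rw [LinearPMap.mem_graph_iff]
  constructor
  · rintro ⟨z, rfl, rfl⟩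
    exact hasStrongDerivZero_apply S z
  · intro h
    exact ⟨⟨x, y, h⟩, rfl, (hasStrongDerivZero_apply S ⟨x, y, h⟩).unique h⟩

end Rescaling

/-! ### The operator Z, its scaled graph and the equivalence. -/

section Main

variable {𝕜 B : Type*} [RCLike 𝕜] [NormedAddCommGroup B] [NormedSpace 𝕜 B]

theorem ChernoffStable.powerBounded {F : ℝ≥0 → B →L[𝕜] B} (hF : ChernoffStable F) (t : ℝ≥0) :
    ∃ M b, PowerBounded (fun n : ℕ => F (t / n)) M b := by
  obtain ⟨-, a, M, hM, h⟩ := hF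
  refine ⟨M, |a| * t, hM, by positivity, fun n m hn => (h n m hn t).trans ?_⟩
  have := le_abs_self a
  gcongr

/-- The graph of `t • Z`. -/
def scaledGraph (Z : B →ₗ.[𝕜] B) (t : ℝ≥0) : Submodule 𝕜 (B × B) :=
  Z.graph.map (LinearMap.prodMap LinearMap.id (((t : ℝ) : 𝕜) • LinearMap.id))

theorem mem_scaledGraph {Z : B →ₗ.[𝕜] B} {t : ℝ≥0} {p : B × B} :
    p ∈ scaledGraph Z t ↔ ∃ x : Z.domain, p = ((x : B), ((t : ℝ) : 𝕜) • Z x) := by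
  constructor
  · rintro ⟨⟨x, y⟩, hxy, rfl⟩
    obtain ⟨z, rfl, rfl⟩ := (Z.mem_graph_iff).1 hxy
    exact ⟨z, rfl⟩
  · rintro ⟨x, rfl⟩
    exact ⟨(x, Z x), Z.mem_graph x, rfl⟩

theorem mem_closure_scaledGraph {Z : B →ₗ.[𝕜] B} {t : ℝ≥0} (ht : 0 < t) {x y : B} :
    (x, ((t : ℝ) : 𝕜) • y) ∈ closure (scaledGraph Z t : Set (B × B)) ↔
      (x, y) ∈ closure (Z.graph : Set (B × B)) := by
  have ht' : ((t : ℝ) : 𝕜) ≠ 0 := by exact_mod_cast ht.ne'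
  constructor
  · intro h
    have := map_mem_closure (f := fun p : B × B => (p.1, (((t : ℝ) : 𝕜)⁻¹) • p.2))
      (t := (Z.graph : Set (B × B))) (by fun_prop) h fun p hp => by
        obtain ⟨z, rfl⟩ := mem_scaledGraph.1 hp
        simp only [inv_smul_smul₀ ht']
        exact Z.mem_graph z
    simpa only [inv_smul_smul₀ ht'] using this
  · intro h
    exact map_mem_closure (f := fun p : B × B => (p.1, ((t : ℝ) : 𝕜) • p.2))
      (by fun_prop) h fun p hp => ⟨p, hp, rfl⟩

theorem nnreal_floor_natCast_mul (n : ℕ) (s : ℝ≥0) :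
    ⌊(n : ℝ≥0) * s⌋₊ = ⌊(n : ℝ) * (s : ℝ)⌋₊ := by
  exact (Nonneg.nat_floor_coe (α := ℝ) ((n : ℝ≥0) * s)).symm

theorem consistent_scaledGraph [NormedSpace ℝ B] [IsScalarTower ℝ 𝕜 B] {Z : B →ₗ.[𝕜] B}
    {F : ℝ≥0 → B →L[𝕜] B} (hF0 : F 0 = 1) (hFZ : Z ≤ strongDerivZero F) {t : ℝ≥0} (ht : 0 < t) :
    Consistent (fun n : ℕ => F (t / n)) (scaledGraph Z t : Set (B × B)) := by
  intro p hp
  obtain ⟨x, rfl⟩ := mem_scaledGraph.1 hp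
  have h : HasStrongDerivZero F (x : B) (Z x) :=
    mem_graph_strongDerivZero.1 (LinearPMap.le_graph_of_le hFZ (Z.mem_graph x))
  refine (h.tendsto_nat ht).congr fun n => ?_
  rw [hF0, one_apply_eq_self, ← RCLike.ofReal_natCast, ← RCLike.real_smul_eq_coe_smul (K := 𝕜)]

theorem dual_separating {F : ℝ≥0 → B →L[𝕜] B} (hF0 : F 0 = 1)
    (hFdual : WeakStarDense ((strongDerivZero (dualFamily F)).domain : Set (StrongDual 𝕜 B)))
    {t : ℝ≥0} (ht : 0 < t) (y : B)
    (hy : ∀ φ ψ, DualConsistent (fun n : ℕ => F (t / n)) φ ψ → φ y = 0) : y = 0 := by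
  refine hFdual.eq_zero fun φ hφ => ?_
  obtain ⟨ψ, hψ⟩ := hφ
  refine hy φ (((t : ℝ) : 𝕜) • ψ) ((hψ.tendsto_nat ht).congr fun n => ?_)
  congr 2
  ext x
  simp [dualFamily, hF0]

/-- If (0, y) is in the closure of the graph, every dual pair gives t φ y = ψ 0 = 0, and such φ
separate points. -/
theorem isClosable_of_dual [NormedSpace ℝ B] [IsScalarTower ℝ 𝕜 B] {Z : B →ₗ.[𝕜] B} {t : ℝ≥0}
    (ht : 0 < t) {G : ℕ → B →L[𝕜] B} (hG : Consistent G (scaledGraph Z t : Set (B × B)))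
    (hsep : ∀ y, (∀ φ ψ, DualConsistent G φ ψ → φ y = 0) → y = 0) : Z.IsClosable := by
  refine ⟨Z.graph.topologicalClosure.toLinearPMap, (Submodule.toLinearPMap_graph_eq _ ?_).symm⟩
  rintro ⟨x, y⟩ hxy rfl
  refine hsep y fun φ ψ hφ => ?_
  have h := hφ.apply_eq hG ((mem_closure_scaledGraph ht).2 hxy)
  have ht' : ((t : ℝ) : 𝕜) ≠ 0 := by exact_mod_cast ht.ne'
  simpa [ht.ne'] using h

theorem isC0Generator_closure_iff {Z : B →ₗ.[𝕜] B} (hZ : Z.IsClosable) :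
    IsC0Generator Z.closure ↔ ∃ T : ℝ≥0 → B →L[𝕜] B, IsC0Semigroup T ∧
      ∀ x y, (x, y) ∈ closure (Z.graph : Set (B × B)) ↔ HasStrongDerivZero T x y := by
  have hgr : ∀ x y, (x, y) ∈ closure (Z.graph : Set (B × B)) ↔ (x, y) ∈ Z.closure.graph := by
    intro x y
    rw [← hZ.graph_closure_eq_closure_graph]
    rfl
  constructor
  · rintro ⟨T, hT, h⟩
    refine ⟨T, hT, fun x y => ?_⟩
    rw [hgr, h, mem_graph_strongDerivZero]
  · rintro ⟨T, hT, h⟩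
    refine ⟨T, hT, LinearPMap.eq_of_eq_graph ?_⟩
    ext ⟨x, y⟩
    rw [← hgr, h, mem_graph_strongDerivZero]

/-- The generator graphs of `T` and of the rescaled semigroup `s ↦ T (t s)`. -/
theorem exists_isC0Semigroup_scaledGraph_iff {Z : B →ₗ.[𝕜] B} {t : ℝ≥0} (ht : 0 < t) :
    (∃ T : ℝ≥0 → B →L[𝕜] B, IsC0Semigroup T ∧
      ∀ x y, (x, y) ∈ closure (scaledGraph Z t : Set (B × B)) ↔ HasStrongDerivZero T x y) ↔
    ∃ T : ℝ≥0 → B →L[𝕜] B, IsC0Semigroup T ∧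
      ∀ x y, (x, y) ∈ closure (Z.graph : Set (B × B)) ↔ HasStrongDerivZero T x y := by
  have ht' : ((t : ℝ) : 𝕜) ≠ 0 := by exact_mod_cast ht.ne'
  have key : ∀ T : ℝ≥0 → B →L[𝕜] B, ∀ x y,
      HasStrongDerivZero (fun s => T (t * s)) x (((t : ℝ) : 𝕜) • y) ↔ HasStrongDerivZero T x y := by
    refine fun T x y => ⟨fun h => ?_, fun h => h.comp_mul ht⟩
    have h1 := h.comp_mul (inv_pos.2 ht)
    simp only [mul_inv_cancel_left₀ ht.ne', NNReal.coe_inv, RCLike.ofReal_inv,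
      inv_smul_smul₀ ht'] at h1
    exact h1
  constructor
  · rintro ⟨T, hT, h⟩
    refine ⟨fun s => T (t⁻¹ * s), hT.comp_mul _, fun x y => ?_⟩
    rw [← mem_closure_scaledGraph ht, h, ← key fun s => T (t⁻¹ * s)]
    have e : ∀ s, t⁻¹ * (t * s) = s := fun s => inv_mul_cancel_left₀ ht.ne' s
    simp only [e]
  · rintro ⟨T, hT, h⟩
    refine ⟨fun s => T (t * s), hT.comp_mul _, fun x y => ?_⟩
    obtain ⟨z, rfl⟩ : ∃ z, y = ((t : ℝ) : 𝕜) • z := ⟨_, (smul_inv_smul₀ ht' y).symm⟩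
    rw [mem_closure_scaledGraph ht, key, h]

/-- Orbits of the limit semigroup are approximated in the graph norm by elements of the domain. -/
theorem exists_approx_of_tendsto {Γ : Submodule 𝕜 (B × B)} {g : ℕ → B} {x y : B}
    (hg : Tendsto g atTop (𝓝 x)) (hxy : (x, y) ∈ closure (Γ : Set (B × B))) :
    ∃ q : ℕ → B × B, (∀ n, q n ∈ Γ) ∧ Tendsto (fun n => ‖g n - (q n).1‖) atTop (𝓝 0) ∧
      Bornology.IsBounded (Set.range fun n => (q n).2) := by
  obtain ⟨q, hq, hlim⟩ := mem_closure_iff_seq_limit.1 hxy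
  have h1 := hg.sub ((continuous_fst.tendsto _).comp hlim)
  rw [sub_self] at h1
  exact ⟨q, hq, tendsto_zero_iff_norm_tendsto_zero.1 h1,
    Metric.isBounded_range_of_tendsto _ ((continuous_snd.tendsto _).comp hlim)⟩

end Main

theorem mainTheorem11 {𝕜 B : Type*} [RCLike 𝕜] [NormedAddCommGroup B] [NormedSpace 𝕜 B]
    [CompleteSpace B]
    (hB : (IsReflexiveSpace 𝕜 B ∧ TopologicalSpace.SeparableSpace B) ∨ HasHilbertNorm 𝕜 B)
    (Z : B →ₗ.[𝕜] B) (hZ : Dense (Z.domain : Set B))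
    (t : ℝ≥0) (ht : 0 < t)
    (F : ℝ≥0 → B →L[𝕜] B)
    (hF : ChernoffStable F)
    (hFZ : Z ≤ strongDerivZero F)
    (hFdual : WeakStarDense
      ((strongDerivZero (dualFamily F)).domain : Set (StrongDual 𝕜 B))) :
    (Z.IsClosable ∧ IsC0Generator Z.closure) ↔
      ∃ A : Submodule 𝕜 B, A ≤ Z.domain ∧ Dense (A : Set B) ∧
        ∀ f ∈ A, ∀ s : ℝ≥0, ∃ f' : ℕ → Z.domain,
          Tendsto (fun n : ℕ => ‖(F (t / n) ^ ⌊(n : ℝ≥0) * s⌋₊) f - (f' n : B)‖) atTop (𝓝 0) ∧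
          Bornology.IsBounded
            (Set.range fun n : ℕ => strongDerivZero F ⟨(f' n : B), hFZ.1 (f' n).2⟩) := by
  let _ : NormedSpace ℝ B := NormedSpace.restrictScalars ℝ 𝕜 B
  have : IsScalarTower ℝ 𝕜 B := RestrictScalars.isScalarTower ℝ 𝕜 B
  have hR : IsReflexiveSpace 𝕜 B := hB.elim (fun h => h.1) fun h => h.isReflexiveSpace
  obtain ⟨M, b, hb⟩ := hF.powerBounded t
  have hG := consistent_scaledGraph hF.1 hFZ ht
  have hsep := dual_separating hF.1 hFdual ht
  have ht' : ((t : ℝ) : 𝕜) ≠ 0 := by exact_mod_cast ht.ne'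
  have hcl : Z.IsClosable := isClosable_of_dual ht hG hsep
  have hZF : ∀ x : Z.domain, strongDerivZero F ⟨(x : B), hFZ.1 x.2⟩ = Z x :=
    fun x => (hFZ.2 rfl).symm
  simp only [nnreal_floor_natCast_mul, hZF]
  rw [isC0Generator_closure_iff hcl, ← exists_isC0Semigroup_scaledGraph_iff ht]
  constructor
  · rintro ⟨-, T, hT, hΓ⟩
    refine ⟨Z.domain, le_rfl, hZ, fun f hf s => ?_⟩
    have hder : HasStrongDerivZero T f (((t : ℝ) : 𝕜) • Z ⟨f, hf⟩) :=
      (hΓ _ _).1 (subset_closure (mem_scaledGraph.2 ⟨⟨f, hf⟩, rfl⟩))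
    have horb : ∀ r, (T r f, T r (((t : ℝ) : 𝕜) • Z ⟨f, hf⟩))
        ∈ closure (scaledGraph Z t : Set (B × B)) :=
      fun r => (hΓ _ _).2 (hT.hasStrongDerivZero_apply hder r)
    obtain ⟨q, hq, hlim, hbdd⟩ :=
      exists_approx_of_tendsto (hT.tendsto_pow_floor hG hb hder horb s) (horb s)
    choose f' hf' using fun n => mem_scaledGraph.1 (hq n)
    refine ⟨f', hlim.congr fun n => by rw [hf' n], ?_⟩
    -- The approximants carry values of `t • Z`; dividing by t gives those of Z.
    refine (hbdd.smul₀ (((t : ℝ) : 𝕜)⁻¹)).subset ?_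
    rintro _ ⟨n, rfl⟩
    refine Set.mem_smul_set.2 ⟨(q n).2, ⟨n, rfl⟩, ?_⟩
    rw [hf' n]
    exact inv_smul_smul₀ ht' _
  · rintro ⟨A, hAZ, hA, happ⟩
    refine ⟨hcl, exists_isC0Semigroup_of_approx hR hG hb hsep hA
      (fun f hf => ⟨_, mem_scaledGraph.2 ⟨⟨f, hAZ hf⟩, rfl⟩⟩) fun f hf s hs => ?_⟩
    lift s to ℝ≥0 using hs
    obtain ⟨f', hlim, hbdd⟩ := happ f hf s
    obtain ⟨R, hR'⟩ := isBounded_iff_forall_norm_le.1 hbdd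
    refine ⟨fun n => (f' n, ((t : ℝ) : 𝕜) • Z (f' n)), fun n => mem_scaledGraph.2 ⟨f' n, rfl⟩,
      tendsto_zero_iff_norm_tendsto_zero.2 hlim, ‖((t : ℝ) : 𝕜)‖ * R, fun n => ?_⟩
    rw [norm_smul]
    exact mul_le_mul_of_nonneg_left (hR' _ ⟨n, rfl⟩) (norm_nonneg _)
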